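/- Let $d\in\{2,3\}$, $k\ge 0$, $\sigma\in\mathbb R$ and $m<4$. There are constants $C>0$ and $D>0$, depending only on $d,k,\sigma,m$, such that the following holds. Let $\mathcal T_h$ be a finite conforming mesh of triangles ($d=2$) or tetrahedra ($d=3$) of the polyhedral open set $\Omega$, the interior of the union of the elements; let $\Gamma=\partial\Omega$. Assume that the mesh is shape-regular with constant $\sigma$: each element $K$ contains a ball of diameter $\rho_K>0$ with $h_K\le\sigma\rho_K$, where $h_K=\operatorname{diam}K$. Let $\kappa>0$ be a coefficient with $\kappa,\kappa^{-1}\in L^\infty(\Omega)$ and $\kappa_{\max}:=\|\kappa\|_{L^\infty(\Omega)}\le m$. Let $\tau$ be a non-negative function on the boundaries of the elements that is constant on each edge/face of each $\partial K$ (it may take two different values on an edge/face shared by two elements), with $$\|\mathfrak h\tau\|_{L^\infty(\partial\mathcal T_h)}:=\max_{K\in\mathcal T_h}\ \max_{e\subset\partial K} h_e\,\tau|_{\partial K,e}\le D,\qquad h_e=\operatorname{diam} e .$$ Let $\boldsymbol V_h$, $W_h$ be the spaces of vector fields, resp. functions, that are polynomials of degree at most $k$ (componentwise) on each element, and let $M_h$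 be the space of functions on the skeleton that are polynomials of degree at most $k$ on each edge/face. Write $(\cdot,\cdot)_{\mathcal T_h}=\sum_K\int_K$, $\langle\cdot,\cdot\rangle_{\partial\mathcal T_h}=\sum_K\int_{\partial K}$, $\langle\cdot,\cdot\rangle_{\partial\mathcal T_h\setminus\Gamma}=\sum_K\int_{\partial K\setminus\Gamma}$, $\langle\cdot,\cdot\rangle_\Gamma=\int_\Gamma$, and let $\mathbf n$ be the outward unit normal on each $\partial K$. Let $(\mathbf q_h,u_h,\widehat u_h)\in\boldsymbol V_h\times W_h\times M_h$ satisfy $$(\mathrm{div}\,\mathbf q_h,w)_{\mathcal T_h}+\langle\tau(u_h-\widehat u_h),w\rangle_{\partial\mathcal T_h}=0\quad\forall w\in W_h,$$ $$\langle\mathbf q_h\cdot\mathbf n+\tau(u_h-\widehat u_h),\widehat v\rangle_{\partial\mathcal T_h\setminus\Gamma}=0\quad\forall\widehat v\in M_h .$$ Then for every $u_\star\in H^1(\Omega)$ (whose trace on $\Gamma$ is meant in $\langle u_\star,\cdot\rangle_\Gamma$), the quantity $$Q:=(\kappa^{-1}\mathbf q_h,\mathbf q_h)_{\mathcal T_h}+\langle\tau(u_h-\widehat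 u_h),u_h-\widehat u_h\rangle_{\partial\mathcal T_h}+\|\nabla u_\star\|_{L^2(\Omega)}^2-\langle u_\star,\mathbf q_h\cdot\mathbf n+\tau(u_h-\widehat u_h)\rangle_\Gamma$$ satisfies $$Q\ge C\Big(\|\mathbf q_h\|_{L^2(\Omega)}^2+\|\nabla u_\star\|_{L^2(\Omega)}^2+\langle\tau(u_h-\widehat u_h),u_h-\widehat u_h\rangle_{\partial\mathcal T_h}\Big).$$ -/

import Mathlib

open MeasureTheory Filter Topology
open scoped ENNReal NNReal

noncomputable section

namespace HDG

/-- `d`-dimensional Euclidean space. -/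
abbrev E (d : ℕ) : Type := EuclideanSpace ℝ (Fin d)

/-! ### Sobolev space and trace -/

/-- `u ∈ H¹(Ω)` with weak gradient `G`: both are square integrable over `Ω`, and
`∫_Ω u ∇φ = - ∫_Ω φ G` for every test function `φ ∈ C_c^∞(Ω)`. -/
structure IsH1 {d : ℕ} (Ω : Set (E d)) (u : E d → ℝ) (G : E d → E d) : Prop where
  memLp : MemLp u 2 (volume.restrict Ω)
  grad_memLp : MemLp G 2 (volume.restrict Ω)
  weak_grad : ∀ φ : E d → ℝ, ContDiff ℝ (⊤ : ℕ∞) φ → HasCompactSupport φ → tsupport φ ⊆ Ω →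
    ∫ x in Ω, u x • gradient φ x = - ∫ x in Ω, φ x • G x

/-- The surface measure on the boundary `∂Ω`: the `(d-1)`-dimensional Hausdorff measure, normalized
as in Euclidean geometry (length for `d = 2`, area for `d = 3`). -/
def bdryMeasure {d : ℕ} (Ω : Set (E d)) : Measure (E d) :=
  (Measure.euclideanHausdorffMeasure (d - 1)).restrict (frontier Ω)

/-- `g ∈ L²(∂Ω)` is the trace of `u ∈ H¹(Ω)` (with weak gradient `G`), the trace operator being the
extension by continuity, from functions smooth up to the boundary to `H¹(Ω)`, of the restriction
to the boundary: `u` is the limit in `H¹(Ω)` of functions `v n ∈ C^∞` whose restrictions to `∂Ω`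
converge to `g` in `L²(∂Ω)`. -/
structure IsTrace {d : ℕ} (Ω : Set (E d)) (u : E d → ℝ) (G : E d → E d) (g : E d → ℝ) : Prop where
  memLp : MemLp g 2 (bdryMeasure Ω)
  approx : ∃ v : ℕ → E d → ℝ, (∀ n, ContDiff ℝ (⊤ : ℕ∞) (v n)) ∧
    Tendsto (fun n => eLpNorm (fun x => v n x - u x) 2 (volume.restrict Ω)) atTop (𝓝 0) ∧
    Tendsto (fun n => eLpNorm (fun x => gradient (v n) x - G x) 2 (volume.restrict Ω))
      atTop (𝓝 0) ∧
    Tendsto (fun n => eLpNorm (fun x => v n x - g x) 2 (bdryMeasure Ω)) atTop (𝓝 0)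

/-- A positive coefficient `κ ∈ L^∞(Ω)` with `κ⁻¹ ∈ L^∞(Ω)`. -/
structure IsDiffusion {d : ℕ} (Ω : Set (E d)) (κ : E d → ℝ) : Prop where
  pos : ∀ᵐ x ∂(volume.restrict Ω), 0 < κ x
  memLp : MemLp κ ⊤ (volume.restrict Ω)
  inv_memLp : MemLp (fun x => (κ x)⁻¹) ⊤ (volume.restrict Ω)

/-! ### Conforming simplicial meshes -/

/-- A finite conforming mesh of triangles (`d = 2`) or tetrahedra (`d = 3`): a finite simplicial
complex in which each simplex is a face of a `d`-dimensional one. Simplices are represented by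
their sets of vertices. -/
structure Mesh (d : ℕ) extends Geometry.SimplicialComplex ℝ (E d) where
  finite : faces.Finite
  pure : ∀ s ∈ faces, ∃ t ∈ faces, s ⊆ t ∧ t.card = d + 1

/-- The closed simplex with the given vertices. -/
abbrev simplex {d : ℕ} (s : Finset (E d)) : Set (E d) := convexHull ℝ (s : Set (E d))

/-- The faces of codimension one of the element `K` (edges for `d = 2`, faces for `d = 3`). -/
def sides {d : ℕ} (K : Finset (E d)) : Finset (Finset (E d)) := K.powersetCard d

/-- The barycenter of the simplex with the given vertices. -/
def barycenter {d : ℕ} (s : Finset (E d)) : E d := (s.card : ℝ)⁻¹ • ∑ x ∈ s, x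

/-- The unit normal on the side `e` of the element `K` that points out of `K`: the normalized
component, orthogonal to `e`, of the vector from the barycenter of `K` to that of `e`. -/
def normal {d : ℕ} (K e : Finset (E d)) : E d :=
  let m := (vectorSpan ℝ (e : Set (E d)))ᗮ.starProjection
    (barycenter e - barycenter K)
  ‖m‖⁻¹ • m

/-- Integration over the side `e`. -/
def sideInt {d : ℕ} (e : Finset (E d)) (f : E d → ℝ) : ℝ :=
  ∫ x in simplex e, f x ∂(Measure.euclideanHausdorffMeasure (d - 1))

namespace Mesh

variable {d : ℕ} (T : Mesh d)

/-- The polyhedral open set `Ω` that is triangulated by the mesh. -/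
def domain : Set (E d) := interior T.space

open Classical in
/-- The elements `K` of the mesh. -/
def elements : Finset (Finset (E d)) := T.finite.toFinset.filter fun s => s.card = d + 1

open Classical in
/-- The sides (edges or faces) of all elements of the mesh. -/
def skeleton : Finset (Finset (E d)) := T.elements.biUnion sides

/-- The side `e` lies on the boundary `Γ` of the domain. -/
def OnBdry (e : Finset (E d)) : Prop := simplex e ⊆ frontier T.domain

/-- Shape regularity with constant `σ`: each element `K` contains a ball of radius `r` such that
`h_K ≤ σ (2 r)`. -/
def IsShapeRegular (σ : ℝ) : Prop :=
  ∀ K ∈ T.elements, ∃ (c : E d) (r : ℝ), 0 < r ∧ Metric.ball c r ⊆ simplex K ∧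
    Metric.diam (simplex K) ≤ σ * (2 * r)

/-- `(·)_{𝒯_h}`: the sum over all elements `K` of the integral of `f K` over `K`. -/
def volInt (f : Finset (E d) → E d → ℝ) : ℝ :=
  ∑ K ∈ T.elements, ∫ x in simplex K, f K x

/-- `⟨·⟩_{∂𝒯_h}`: the sum over all elements `K` of the integral over `∂K` of the function given by
`f K e` on the side `e` of `K`. -/
def bdryInt (f : Finset (E d) → Finset (E d) → E d → ℝ) : ℝ :=
  ∑ K ∈ T.elements, ∑ e ∈ sides K, sideInt e (f K e)

open Classical in
/-- `⟨·⟩_{∂𝒯_h∖Γ}`: as `bdryInt`, over the sides that are not on `Γ`. -/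
def innerInt (f : Finset (E d) → Finset (E d) → E d → ℝ) : ℝ :=
  ∑ K ∈ T.elements, ∑ e ∈ sides K with ¬ T.OnBdry e, sideInt e (f K e)

open Classical in
/-- `⟨·⟩_Γ`: as `bdryInt`, over the sides that are on `Γ` (each of them is a side of precisely one
element, and together they make up `Γ`). -/
def gammaInt (f : Finset (E d) → Finset (E d) → E d → ℝ) : ℝ :=
  ∑ K ∈ T.elements, ∑ e ∈ sides K with T.OnBdry e, sideInt e (f K e)

/-- `‖𝔥τ‖_{L^∞(∂𝒯_h)}`, where `τ` has the constant value `τ K e` on the side `e` of `K`, and `𝔥`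
is the diameter `h_e` on `e`. -/
def hTauNorm (τ : Finset (E d) → Finset (E d) → ℝ) : ℝ≥0 :=
  T.elements.sup fun K => (sides K).sup fun e => ‖Metric.diam (simplex e) * τ K e‖₊

end Mesh

/-! ### Discrete spaces

A polynomial on a simplex with non-empty interior is identified with the polynomial on the whole
space, and a polynomial on a side is the restriction to this side of a polynomial on the whole
space of the same degree. -/

/-- Polynomials in `d` variables of degree at most `k`. -/
def polys (d k : ℕ) : Set (E d → ℝ) :=
  {f | ∃ p : MvPolynomial (Fin d) ℝ, p.totalDegree ≤ k ∧
    ∀ x, f x = MvPolynomial.eval (fun i => x i) p}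

/-- Vector fields whose components are polynomials of degree at most `k`. -/
def vecPolys (d k : ℕ) : Set (E d → E d) :=
  {v | ∀ i, (fun x => v x i) ∈ polys d k}

/-- The divergence of a vector field. -/
def divergence {d : ℕ} (v : E d → E d) (x : E d) : ℝ :=
  ∑ i, fderiv ℝ v x (EuclideanSpace.single i 1) i

namespace Mesh

variable {d : ℕ} (T : Mesh d) (k : ℕ)

/-- `𝐕_h`: piecewise polynomial vector fields; `q K` is the field on the element `K`. -/
def Vh : Set (Finset (E d) → E d → E d) := {q | ∀ K ∈ T.elements, q K ∈ vecPolys d k}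

/-- `W_h`: piecewise polynomial functions; `w K` is the function on the element `K`. -/
def Wh : Set (Finset (E d) → E d → ℝ) := {w | ∀ K ∈ T.elements, w K ∈ polys d k}

/-- `M_h`: piecewise polynomial functions on the skeleton, single valued on each side; `v e` is the
function on the side `e`. -/
def Mh : Set (Finset (E d) → E d → ℝ) :=
  {v | ∀ e ∈ T.skeleton, ∃ p ∈ polys d k, Set.EqOn (v e) p (simplex e)}

/-- The numerical normal flux `q_h·n + τ(u_h - û_h)` on the side `e` of the element `K`. -/
def flux (τ : Finset (E d) → Finset (E d) → ℝ) (q : Finset (E d) → E d → E d)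
    (u uhat : Finset (E d) → E d → ℝ) (K e : Finset (E d)) (x : E d) : ℝ :=
  inner ℝ (q K x) (normal K e) + τ K e * (u K x - uhat e x)

/-- `⟨τ(u_h - û_h), u_h - û_h⟩_{∂𝒯_h}`. -/
def tauForm (τ : Finset (E d) → Finset (E d) → ℝ)
    (u uhat : Finset (E d) → E d → ℝ) : ℝ :=
  T.bdryInt fun K e x => τ K e * (u K x - uhat e x) * (u K x - uhat e x)

/-- The discrete divergence equation
`(div q_h, w)_{𝒯_h} + ⟨τ(u_h - û_h), w⟩_{∂𝒯_h} = 0` for all `w ∈ W_h`. -/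
def DivEq (τ : Finset (E d) → Finset (E d) → ℝ) (q : Finset (E d) → E d → E d)
    (u uhat : Finset (E d) → E d → ℝ) : Prop :=
  ∀ w ∈ T.Wh k, T.volInt (fun K x => divergence (q K) x * w K x) +
    T.bdryInt (fun K e x => τ K e * (u K x - uhat e x) * w K x) = 0

/-- Flux continuity: `⟨q_h·n + τ(u_h - û_h), v⟩_{∂𝒯_h∖Γ} = 0` for all `v ∈ M_h`. -/
def FluxEq (τ : Finset (E d) → Finset (E d) → ℝ) (q : Finset (E d) → E d → E d)
    (u uhat : Finset (E d) → E d → ℝ) : Prop :=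
  ∀ v ∈ T.Mh k, T.innerInt (fun K e x => flux τ q u uhat K e x * v e x) = 0

/-- The quadratic form `Q`, for `u⋆ ∈ H¹(Ω)` with weak gradient `G` and trace `g`. -/
def formQ (κ : E d → ℝ) (τ : Finset (E d) → Finset (E d) → ℝ) (q : Finset (E d) → E d → E d)
    (u uhat : Finset (E d) → E d → ℝ) (G : E d → E d) (g : E d → ℝ) : ℝ :=
  T.volInt (fun K x => inner ℝ ((κ x)⁻¹ • q K x) (q K x)) + T.tauForm τ u uhat +
    (∫ x in T.domain, ‖G x‖ ^ 2) - T.gammaInt (fun K e x => g x * flux τ q u uhat K e x)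

end Mesh

end HDG

end

open HDG

/-! The only term of Q without a sign is the boundary term, and it becomes computable once it is
pulled back into the elements. Let f be smooth and p its elementwise `L²` projection onto
polynomials of degree at most k. The numerical flux on an interior side is itself a polynomial of
degree at most k, so flux continuity makes the sum of its values from the adjacent elements vanish
there, and the integral over Γ may be extended to all element boundaries. The divergence theorem,
the orthogonality of f - p to div q, and the divergence equation tested with p then give ⟨f, flux⟩_Γ
= (∇f, q) + ⟨τ(u - û), f - p⟩ over all element boundaries (`gammaInt_mul_flux`).

Young's inequality bounds the first term by θ‖∇f‖² + (4θ)⁻¹‖q‖². The second is at most half of the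
τ-form plus half of Σ τ‖f - p‖² over the sides, and ‖f - p‖² on a side e of K is at most C h_e ‖∇f‖²
on K (`exists_projection_trace`), so smallness of h_e τ makes this a small multiple of ‖∇f‖². The
term (κ⁻¹q, q) is at least M⁻¹‖q‖² for an upper bound M of κ. Absorption therefore requires θ < 1
and M < 4θ simultaneously, which is possible exactly when M < 4. Density of smooth functions carries
the bound to `H¹` functions with a trace (`gammaInt_trace_mul_flux_le`).

The side estimate combines three facts on a simplex: a trace inequality from the divergence theorem
for the field z²(x - v), a Poincaré inequality on convex sets with an explicit constant, and an
inverse inequality for polynomials obtained by scaling from the unit ball. The divergence theorem on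
a simplex is itself proved by integrating along lines parallel to an edge, since barycentric
coordinates make both endpoints of each chord explicit. -/

namespace HDG

/-! ### Surface measure on hyperplanes -/

/-- The surface measure on the hyperplane through `p` with normal `n`. -/
noncomputable def planeMeasure {d : ℕ} (n p : E d) : Measure (E d) :=
  (Measure.euclideanHausdorffMeasure (d - 1)).restrict {x | inner ℝ n (x - p) = 0}

variable {d : ℕ}

/-- Translation by p embeds the orthogonal complement of n isometrically onto the hyperplane.
Isometries carry Hausdorff measures over, and in dimension d - 1 the normalized Hausdorff measure is
Lebesgue measure. -/
lemma planeMeasure_eq_map {n : E d} (hn : ‖n‖ = 1) (p : E d) :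
    planeMeasure n p = (volume : Measure (ℝ ∙ n)ᗮ).map (fun y : (ℝ ∙ n)ᗮ => p + (y : E d)) := by
  have hn0 : n ≠ 0 := by rintro rfl; simp at hn
  have hfr : Module.finrank ℝ (ℝ ∙ n)ᗮ = d - 1 := by
    have h1 := (ℝ ∙ n).finrank_add_finrank_orthogonal
    rw [finrank_span_singleton hn0, finrank_euclideanSpace_fin] at h1
    omega
  have hiso : Isometry (fun y : (ℝ ∙ n)ᗮ => p + (y : E d)) :=
    (isometry_add_left p).comp isometry_subtype_coe
  have h := hiso.map_euclideanHausdorffMeasure (d := d - 1)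
  rw [← InnerProductSpace.euclideanHausdorffMeasure_eq_volume, hfr, h, planeMeasure]
  congr 1
  ext x
  simp only [Set.mem_ofPred_eq, Set.mem_range]
  constructor
  · intro hx
    exact ⟨⟨x - p, Submodule.mem_orthogonal_singleton_iff_inner_right.2 hx⟩, by simp⟩
  · rintro ⟨y, rfl⟩
    simpa using Submodule.mem_orthogonal_singleton_iff_inner_right.1 y.2

lemma sFinite_planeMeasure {n : E d} (hn : ‖n‖ = 1) (p : E d) : SFinite (planeMeasure n p) := by
  rw [planeMeasure_eq_map hn]
  infer_instance

lemma planeMeasure_lt_top {n : E d} (hn : ‖n‖ = 1) (p : E d) {s : Set (E d)}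
    (hs : IsCompact s) : planeMeasure n p s < ∞ := by
  rw [planeMeasure_eq_map hn, Measure.map_apply (by fun_prop) hs.measurableSet]
  have hiso : Isometry (fun y : (ℝ ∙ n)ᗮ => p + (y : E d)) :=
    (isometry_add_left p).comp isometry_subtype_coe
  have hc : Topology.IsClosedEmbedding (fun y : (ℝ ∙ n)ᗮ => p + (y : E d)) :=
    hiso.isClosedEmbedding
  exact (hc.isCompact_preimage hs).measure_lt_top (μ := (volume : Measure (ℝ ∙ n)ᗮ))

/-- Integration over lines with direction `w` through the points of a hyperplane. -/
lemma map_lines_planeMeasure {n : E d} (hn : ‖n‖ = 1) (p : E d) {w : E d}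
    (hw : inner ℝ n w ≠ 0) :
    ((volume : Measure ℝ).prod (planeMeasure n p)).map (fun z => z.2 + z.1 • w)
      = ENNReal.ofReal |inner ℝ n w|⁻¹ • volume := by
  set c : ℝ := inner ℝ n w with hc
  set V := (ℝ ∙ n)ᗮ with hV
  have hwc : w - c • n ∈ V := by
    rw [hV, Submodule.mem_orthogonal_singleton_iff_inner_right, inner_sub_right, inner_smul_right,
      real_inner_self_eq_norm_sq, hn, hc]
    simp
  let u : V := ⟨w - c • n, hwc⟩
  -- the shear
  have h1 : MeasurePreserving (fun z : ℝ × V => (z.1, z.2 + z.1 • u))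
      ((volume : Measure ℝ).prod (volume : Measure V))
      ((volume : Measure ℝ).prod (volume : Measure V)) := by
    refine MeasurePreserving.skew_product (g := fun t y => y + t • u)
      (MeasurePreserving.id _) ?_ ?_
    · fun_prop
    · exact ae_of_all _ fun t => (measurePreserving_add_right volume (t • u)).map_eq
  -- the scaling
  have h2 : ((volume : Measure ℝ).prod (volume : Measure V)).map
      (Prod.map (fun t : ℝ => t * c) (id : V → V))
      = ENNReal.ofReal |c|⁻¹ • (volume : Measure ℝ).prod (volume : Measure V) := by
    rw [← Measure.map_prod_map _ _ (by fun_prop) measurable_id, Real.map_volume_mul_right hw,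
      Measure.map_id, Measure.prod_smul_left, abs_inv]
  -- the orthogonal decomposition
  have h3 : MeasurePreserving (fun z : ℝ × V => p + ((z.2 : E d) + z.1 • n))
      ((volume : Measure ℝ).prod (volume : Measure V)) (volume : Measure (E d)) := by
    have e1 := (LinearIsometryEquiv.toSpanUnitSingleton (𝕜 := ℝ) n hn).measurePreserving
    have e2 := ((ℝ ∙ n).measurePreserving_measurableEquivProd p).symm
    rw [InnerProductSpace.euclideanHausdorffMeasure_eq_volume] at e2
    have e3 := e2.comp (e1.prod (MeasurePreserving.id (volume : Measure V)))
    have e4 : (fun z : ℝ × V => p + ((z.2 : E d) + z.1 • n)) =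
        ((ℝ ∙ n).measurableEquivProd p).symm ∘
          Prod.map (LinearIsometryEquiv.toSpanUnitSingleton (𝕜 := ℝ) n hn) id := by
      funext z
      simp only [Function.comp_apply, Prod.map, id, Submodule.measurableEquivProd_symm_apply,
        LinearIsometryEquiv.toSpanUnitSingleton_apply, vadd_eq_add]
      abel
    rw [e4]
    exact e3
  have hsf := sFinite_planeMeasure hn p
  have h4 : (volume : Measure ℝ).prod (planeMeasure n p)
      = ((volume : Measure ℝ).prod (volume : Measure V)).map
        (Prod.map (id : ℝ → ℝ) (fun y : V => p + (y : E d))) := by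
    rw [planeMeasure_eq_map hn, ← Measure.map_prod_map _ _ measurable_id (by fun_prop),
      Measure.map_id]
  rw [h4, Measure.map_map (by fun_prop) (by fun_prop)]
  -- With w = c n + u and u orthogonal to n, the map is a shear by t u, then scaling of t by c, then
  -- the orthogonal decomposition. Only the scaling changes the measure, by |c|⁻¹.
  have h5 : (fun z : ℝ × E d => z.2 + z.1 • w) ∘ Prod.map (id : ℝ → ℝ) (fun y : V => p + (y : E d))
      = (fun z : ℝ × V => p + ((z.2 : E d) + z.1 • n)) ∘
        (Prod.map (fun t : ℝ => t * c) (id : V → V)) ∘ (fun z : ℝ × V => (z.1, z.2 + z.1 • u)) := by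
    ext1 z
    simp only [Function.comp_apply, Prod.map, id, u, Submodule.coe_add, Submodule.coe_smul,
      smul_sub, mul_smul]
    abel
  rw [h5, ← Measure.map_map h3.measurable (by fun_prop), ← Measure.map_map (by fun_prop)
    h1.measurable, h1.map_eq, h2, Measure.map_smul, h3.map_eq]

/-- Two hyperplane measures compared along the lines with direction `w`: if `π` is the projection
along `w` onto the second hyperplane, given by an affine function `l`. -/
lemma map_proj_planeMeasure {n₁ n₂ : E d} (hn₁ : ‖n₁‖ = 1) (hn₂ : ‖n₂‖ = 1) (p₁ p₂ : E d)
    {w : E d} (hw₁ : inner ℝ n₁ w ≠ 0) (hw₂ : inner ℝ n₂ w ≠ 0) (l : E d → ℝ) (hl : Continuous l)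
    (hlw : ∀ (x : E d) (t : ℝ), l (x + t • w) = l x + t) (hl₂ : ∀ x, inner ℝ n₂ (x - p₂) = 0 → l x = 0) :
    ENNReal.ofReal |inner ℝ n₁ w| • (planeMeasure n₁ p₁).map (fun x => x - l x • w)
      = ENNReal.ofReal |inner ℝ n₂ w| • planeMeasure n₂ p₂ := by
  have hsf₁ := sFinite_planeMeasure hn₁ p₁
  have hsf₂ := sFinite_planeMeasure hn₂ p₂
  have hmeas : Measurable (fun x => x - l x • w) := by fun_prop
  ext s hs
  have hinv : ∀ (x : E d) (t : ℝ), x + t • w - l (x + t • w) • w = x - l x • w := by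
    intro x t; rw [hlw]; module
  -- B is a slab over s: every line in direction w that projects into s meets it in a parameter
  -- interval of length one, and other lines miss it. Slicing from either hyperplane computes the
  -- volume of the same B.
  let B : Set (E d) := (fun x => x - l x • w) ⁻¹' s ∩ l ⁻¹' Set.Icc 0 1
  have hB : MeasurableSet B := (hmeas hs).inter (hl.measurable measurableSet_Icc)
  have hBmem : ∀ (x : E d) (t : ℝ), x + t • w ∈ B ↔
      x - l x • w ∈ s ∧ 0 ≤ l x + t ∧ l x + t ≤ 1 := by
    intro x t
    change x + t • w - l (x + t • w) • w ∈ s ∧ l (x + t • w) ∈ Set.Icc 0 1 ↔ _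
    rw [hinv, hlw, Set.mem_Icc]
  have key : ∀ {n : E d} (_ : ‖n‖ = 1) (p : E d) (_ : inner ℝ n w ≠ 0),
      ENNReal.ofReal |inner ℝ n w| * planeMeasure n p ((fun x => x - l x • w) ⁻¹' s)
        = volume B := by
    intro n hn p hw
    have hsf := sFinite_planeMeasure hn p
    have h := congrArg (fun μ => μ B) (map_lines_planeMeasure hn p hw)
    rw [Measure.map_apply (by fun_prop) hB, Measure.prod_apply_symm ((by fun_prop : Measurable
      (fun z : ℝ × E d => z.2 + z.1 • w)) hB)] at h
    have h6 : ∀ x, volume ((fun t : ℝ => (t, x)) ⁻¹' ((fun z : ℝ × E d => z.2 + z.1 • w) ⁻¹' B))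
        = Set.indicator ((fun x => x - l x • w) ⁻¹' s) (fun _ => 1) x := by
      intro x
      by_cases hx : x - l x • w ∈ s
      · rw [Set.indicator_of_mem (by exact hx)]
        have : ((fun t : ℝ => (t, x)) ⁻¹' ((fun z : ℝ × E d => z.2 + z.1 • w) ⁻¹' B))
          = Set.Icc (- l x) (1 - l x) := by
          ext t
          rw [Set.mem_preimage, Set.mem_preimage, hBmem, Set.mem_Icc]
          constructor
          · rintro ⟨-, h1, h2⟩
            constructor <;> linarith
          · rintro ⟨h1, h2⟩
            exact ⟨hx, by linarith, by linarith⟩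
        rw [this, Real.volume_Icc]
        simp
      · rw [Set.indicator_of_notMem (by exact hx)]
        convert measure_empty (μ := (volume : Measure ℝ))
        ext t
        rw [Set.mem_preimage, Set.mem_preimage, hBmem]
        simp [hx]
    simp_rw [h6] at h
    rw [lintegral_indicator_const (hmeas hs), one_mul] at h
    rw [h, Measure.smul_apply, smul_eq_mul, ← mul_assoc, ← ENNReal.ofReal_mul (abs_nonneg _),
      mul_inv_cancel₀ (abs_ne_zero.2 hw), ENNReal.ofReal_one, one_mul]
  rw [Measure.smul_apply, Measure.map_apply hmeas hs, smul_eq_mul, key hn₁ p₁ hw₁,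
    ← key hn₂ p₂ hw₂, Measure.smul_apply, smul_eq_mul]
  congr 1
  rw [planeMeasure, Measure.restrict_apply hs, Measure.restrict_apply (hmeas hs)]
  congr 1
  ext x
  simp only [Set.mem_inter_iff, Set.mem_preimage, Set.mem_ofPred_eq]
  refine and_congr_left fun hx => ?_
  rw [hl₂ x hx]; simp

/-! ### Barycentric coordinates of a simplex -/

section Simplex

open scoped Classical

variable {d : ℕ} {K : Finset (E d)}

/-- `lam v` is the barycentric coordinate of the simplex `K` at the vertex `v`. -/
structure IsBary (K : Finset (E d)) (lam : E d → E d →ᵃ[ℝ] ℝ) : Prop where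
  self : ∀ v ∈ K, lam v v = 1
  other : ∀ v ∈ K, ∀ u ∈ K, u ≠ v → lam v u = 0
  sum_one : ∀ x, ∑ v ∈ K, lam v x = 1
  sum_smul : ∀ x, ∑ v ∈ K, lam v x • v = x

lemma exists_isBary (hK : AffineIndependent ℝ ((↑) : K → E d)) (hcard : K.card = d + 1) :
    ∃ lam, IsBary K lam := by
  have htop : affineSpan ℝ (Set.range ((↑) : K → E d)) = ⊤ := by
    rw [hK.affineSpan_eq_top_iff_card_eq_finrank_add_one]
    simp [hcard]
  let b : AffineBasis K ℝ (E d) := ⟨(↑), hK, htop⟩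
  have hb : ∀ v : K, b v = v := fun v => rfl
  refine ⟨fun v => if h : v ∈ K then b.coord ⟨v, h⟩ else AffineMap.const ℝ _ 0, ?_, ?_, ?_, ?_⟩
  · intro v hv
    simp only [hv, dite_true]
    have := b.coord_apply ⟨v, hv⟩ ⟨v, hv⟩
    simpa [hb] using this
  · intro v hv u hu huv
    simp only [hv, dite_true]
    have := b.coord_apply ⟨v, hv⟩ ⟨u, hu⟩
    rw [if_neg (by simpa [Subtype.ext_iff] using huv.symm)] at this
    simpa [hb] using this
  · intro x
    rw [← Finset.sum_coe_sort]
    simpa using b.sum_coord_apply_eq_one x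
  · intro x
    rw [← Finset.sum_coe_sort]
    simpa [hb] using b.linear_combination_coord_eq_self x

namespace IsBary

variable {lam : E d → E d →ᵃ[ℝ] ℝ}

lemma continuous (lam : E d → E d →ᵃ[ℝ] ℝ) (v : E d) : Continuous (lam v) :=
  (lam v).continuous_of_finiteDimensional

lemma mem_simplex_iff (h : IsBary K lam) {x : E d} :
    x ∈ simplex K ↔ ∀ v ∈ K, 0 ≤ lam v x := by
  constructor
  · intro hx v hv
    have hconv : Convex ℝ {y | 0 ≤ lam v y} := (convex_Ici (0 : ℝ)).affine_preimage (lam v)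
    refine convexHull_min (s := (K : Set (E d))) (t := {y | 0 ≤ lam v y}) ?_ hconv hx
    intro u hu
    by_cases huv : u = v
    · subst huv; simp [h.self u hv]
    · simp [h.other v hv u hu huv]
  · intro hx
    exact Finset.mem_convexHull'.2 ⟨fun v => lam v x, hx, h.sum_one x, h.sum_smul x⟩

lemma mem_side_iff (h : IsBary K lam) {v : E d} (hv : v ∈ K) {x : E d} :
    x ∈ simplex (K.erase v) ↔ x ∈ simplex K ∧ lam v x = 0 := by
  constructor
  · intro hx
    refine ⟨convexHull_mono (by simp) hx, ?_⟩
    have hconv : Convex ℝ {y | lam v y = 0} := (convex_singleton (0 : ℝ)).affine_preimage (lam v)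
    refine convexHull_min (t := {y | lam v y = 0}) ?_ hconv hx
    intro u hu
    have hu' := Finset.mem_erase.1 (Finset.mem_coe.1 hu)
    exact h.other v hv u hu'.2 hu'.1
  · rintro ⟨hx, hvx⟩
    rw [h.mem_simplex_iff] at hx
    refine Finset.mem_convexHull'.2 ⟨fun v => lam v x, fun u hu => hx u (Finset.mem_of_mem_erase hu),
      ?_, ?_⟩
    · rw [← h.sum_one x, ← Finset.add_sum_erase _ _ hv, hvx, zero_add]
    · conv_rhs => rw [← h.sum_smul x, ← Finset.add_sum_erase _ _ hv, hvx]
      simp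

lemma linear_sub (_ : IsBary K lam) (v a b : E d) :
    (lam v).linear (a - b) = lam v a - lam v b := by
  simpa using (lam v).linearMap_vsub a b

lemma add_smul (v x w : E d) (t : ℝ) :
    lam v (x + t • w) = lam v x + t * (lam v).linear w := by
  have := (lam v).map_vadd x (t • w)
  simp only [vadd_eq_add, map_smul, smul_eq_mul] at this
  rw [add_comm, this, add_comm]

lemma sum_linear (h : IsBary K lam) (w : E d) : ∑ v ∈ K, (lam v).linear w = 0 := by
  have h1 := h.sum_one w
  have h0 := h.sum_one 0
  have : ∀ v, (lam v).linear w = lam v w - lam v 0 := fun v => by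
    rw [← h.linear_sub, sub_zero]
  simp_rw [this, Finset.sum_sub_distrib, h1, h0, sub_self]

lemma sum_linear_smul (h : IsBary K lam) (w : E d) : ∑ v ∈ K, (lam v).linear w • v = w := by
  have h1 := h.sum_smul w
  have h0 := h.sum_smul 0
  have : ∀ v, (lam v).linear w = lam v w - lam v 0 := fun v => by
    rw [← h.linear_sub, sub_zero]
  simp_rw [this, sub_smul, Finset.sum_sub_distrib, h1, h0, sub_zero]

end IsBary

/-- The height of the simplex `K` over the side opposite the vertex `v`. -/
noncomputable def height (K : Finset (E d)) (v : E d) : ℝ :=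
  inner ℝ (normal K (K.erase v)) (barycenter (K.erase v) - v)

lemma barycenter_mem_simplex {s : Finset (E d)} (hs : s.Nonempty) : barycenter s ∈ simplex s := by
  have : barycenter s = s.centerMass (fun _ => (1 : ℝ)) id := by
    simp [barycenter, Finset.centerMass]
  rw [this]
  refine Finset.centerMass_id_mem_convexHull _ (by simp) ?_
  simpa using hs.card_pos

/-- The barycenter of K divides the median from v in the ratio d : 1. This links `normal`, defined
through barycenters, to `height`, defined through v. -/
lemma barycenter_sub_barycenter (hcard : K.card = d + 1) (hd : 0 < d) {v : E d} (hv : v ∈ K) :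
    barycenter (K.erase v) - barycenter K
      = ((d : ℝ) + 1)⁻¹ • (barycenter (K.erase v) - v) := by
  have hce : (K.erase v).card = d := by rw [Finset.card_erase_of_mem hv, hcard]; simp
  have hd' : (d : ℝ) ≠ 0 := by positivity
  have hd1 : (d : ℝ) + 1 ≠ 0 := by positivity
  unfold barycenter
  rw [hce, hcard, ← Finset.add_sum_erase _ _ hv]
  set S := ∑ x ∈ K.erase v, x
  push_cast
  have e1 : (d : ℝ)⁻¹ • S = ((d : ℝ) + 1)⁻¹ • ((d : ℝ)⁻¹ • S) + ((d : ℝ) + 1)⁻¹ • S := by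
    rw [smul_smul, ← _root_.add_smul]
    congr 1
    field_simp
    ring
  nth_rewrite 1 [e1]
  module

namespace IsBary

variable {lam : E d → E d →ᵃ[ℝ] ℝ}

/-- Both the inner product with the normal and `lam v` are affine and constant on the side, hence
affinely related. The relation is checked at the vertices and extended by barycentric combinations;
`height` is the drop of the first function as the second goes from 0 to 1. -/
lemma normal_height (h : IsBary K lam) (hcard : K.card = d + 1) (hd : 0 < d) {v : E d}
    (hv : v ∈ K) :
    ‖normal K (K.erase v)‖ = 1 ∧ 0 < height K v ∧
    ∀ x, inner ℝ (normal K (K.erase v)) x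
      = inner ℝ (normal K (K.erase v)) (barycenter (K.erase v)) - height K v * lam v x := by
  set e := K.erase v with he
  set W := vectorSpan ℝ (e : Set (E d)) with hW
  have hce : e.card = d := by rw [he, Finset.card_erase_of_mem hv, hcard]; simp
  have hene : e.Nonempty := by rw [← Finset.card_pos, hce]; exact hd
  have hbe : barycenter e ∈ affineSpan ℝ (e : Set (E d)) :=
    convexHull_subset_affineSpan _ (barycenter_mem_simplex hene)
  have hbl : lam v (barycenter e) = 0 := ((h.mem_side_iff hv).1 (barycenter_mem_simplex hene)).2
  have hWl : ∀ w ∈ W, (lam v).linear w = 0 := by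
    intro w hw
    have : W ≤ LinearMap.ker (lam v).linear := by
      rw [hW, vectorSpan_def, Submodule.span_le]
      rintro _ ⟨a, ha, b, hb, rfl⟩
      have ha' := Finset.mem_erase.1 (Finset.mem_coe.1 ha)
      have hb' := Finset.mem_erase.1 (Finset.mem_coe.1 hb)
      simp only [SetLike.mem_coe, LinearMap.mem_ker, vsub_eq_sub]
      rw [h.linear_sub, h.other v hv a ha'.2 ha'.1, h.other v hv b hb'.2 hb'.1, sub_zero]
    exact this hw
  set g := barycenter e - v with hg
  set m := Wᗮ.starProjection (barycenter e - barycenter K) with hm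
  have hmg : m = ((d : ℝ) + 1)⁻¹ • Wᗮ.starProjection g := by
    rw [hm, he, barycenter_sub_barycenter hcard hd hv, map_smul]
  -- The linear part of `lam v` kills the directions of the side but equals -1 on `barycenter e -
  -- v`, so that vector is not parallel to the side.
  have hm0 : m ≠ 0 := by
    intro h0
    have : Wᗮ.starProjection g = 0 := by
      rw [hmg] at h0
      exact (smul_eq_zero.1 h0).resolve_left (by positivity)
    rw [Submodule.starProjection_apply_eq_zero_iff, Submodule.orthogonal_orthogonal] at this
    have h1 := hWl _ this
    rw [hg, h.linear_sub, hbl, h.self v hv] at h1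
    norm_num at h1
  have hn : normal K e = ‖m‖⁻¹ • m := rfl
  have hnorm : ‖normal K e‖ = 1 := by
    rw [hn, norm_smul, norm_inv, norm_norm, inv_mul_cancel₀ (norm_ne_zero_iff.2 hm0)]
  have hnW : normal K e ∈ Wᗮ := by
    rw [hn, hm]
    exact Submodule.smul_mem _ _ (Submodule.starProjection_apply_mem _ _)
  have hmm : inner ℝ m (barycenter e - barycenter K) = ‖m‖ ^ 2 := by
    have hmW : m ∈ Wᗮ := by rw [hm]; exact Submodule.starProjection_apply_mem _ _
    have h1 := Submodule.inner_starProjection_left_eq_right Wᗮ m (barycenter e - barycenter K)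
    rw [(Submodule.starProjection_eq_self_iff).2 hmW] at h1
    rw [h1, ← hm, real_inner_self_eq_norm_sq]
  have hH : height K v = ((d : ℝ) + 1) * ‖m‖ := by
    have h2 : barycenter e - v = ((d : ℝ) + 1) • (barycenter e - barycenter K) := by
      rw [he, barycenter_sub_barycenter hcard hd hv, smul_smul, mul_inv_cancel₀ (by positivity),
        one_smul]
    rw [height, ← he, h2, inner_smul_right, hn, inner_smul_left, hmm]
    simp only [conj_trivial]
    field_simp [norm_ne_zero_iff.2 hm0]
  refine ⟨hnorm, ?_, ?_⟩
  · rw [hH]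
    have := norm_pos_iff.2 hm0
    positivity
  · have hvert : ∀ u ∈ K, inner ℝ (normal K e) u
        = inner ℝ (normal K e) (barycenter e) - height K v * lam v u := by
      intro u hu
      by_cases huv : u = v
      · subst huv
        rw [h.self u hu, height, ← he, inner_sub_right]
        ring
      · rw [h.other v hv u hu huv, mul_zero, sub_zero]
        have hue : u ∈ affineSpan ℝ (e : Set (E d)) :=
          subset_affineSpan _ _ (by simpa [he] using And.intro hu huv)
        have h3 : u - barycenter e ∈ W := by
          rw [hW, ← direction_affineSpan]
          exact AffineSubspace.vsub_mem_direction hue hbe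
        have h4 := (Submodule.mem_orthogonal' _ _).1 hnW _ h3
        rw [inner_sub_right] at h4
        linarith
    intro x
    conv_lhs => rw [← h.sum_smul x]
    rw [inner_sum]
    simp_rw [inner_smul_right]
    rw [Finset.sum_congr rfl (fun u hu => by rw [hvert u hu])]
    simp_rw [mul_sub, Finset.sum_sub_distrib, ← Finset.sum_mul, h.sum_one]
    rw [one_mul]
    congr 1
    rw [Finset.sum_eq_single v]
    · rw [h.self v hv]; ring
    · intro u hu huv
      rw [h.other v hv u hu huv]; ring
    · exact fun h' => absurd hv h'

lemma inner_normal (h : IsBary K lam) (hcard : K.card = d + 1) (hd : 0 < d) {v : E d}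
    (hv : v ∈ K) (w : E d) :
    inner ℝ (normal K (K.erase v)) w = - (height K v * (lam v).linear w) := by
  obtain ⟨-, -, h3⟩ := h.normal_height hcard hd hv
  have h1 := h3 w
  have h0 := h3 0
  rw [inner_zero_right] at h0
  have : (lam v).linear w = lam v w - lam v 0 := by rw [← h.linear_sub, sub_zero]
  rw [this, h1]
  linarith

end IsBary

lemma sides_eq_image (hcard : K.card = d + 1) : sides K = K.image K.erase := by
  ext e
  simp only [sides, Finset.mem_powersetCard, Finset.mem_image]
  constructor
  · rintro ⟨hs, hc⟩
    have h1 : (K \ e).card = 1 := by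
      rw [Finset.card_sdiff_of_subset hs, hcard, hc]; simp
    obtain ⟨v, hv⟩ := Finset.card_eq_one.1 h1
    have hvK : v ∈ K := (Finset.mem_sdiff.1 (hv ▸ Finset.mem_singleton_self v)).1
    refine ⟨v, hvK, ?_⟩
    rw [← Finset.sdiff_singleton_eq_erase, ← hv, Finset.sdiff_sdiff_eq_self hs]
  · rintro ⟨v, hv, rfl⟩
    exact ⟨Finset.erase_subset _ _, by rw [Finset.card_erase_of_mem hv, hcard]; simp⟩

lemma sum_sides (hcard : K.card = d + 1) {M : Type*} [AddCommMonoid M]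
    (f : Finset (E d) → M) : ∑ e ∈ sides K, f e = ∑ v ∈ K, f (K.erase v) := by
  rw [sides_eq_image hcard, Finset.sum_image]
  intro a ha b hb hab
  exact (Finset.erase_inj K ha).1 hab

lemma isCompact_simplex (s : Finset (E d)) : IsCompact (simplex s) :=
  Set.Finite.isCompact_convexHull (𝕜 := ℝ) s.finite_toSet

end Simplex

/-! ### The divergence theorem on a simplex -/

section Divergence

open scoped Classical

variable {d : ℕ} {K : Finset (E d)} {lam : E d → E d →ᵃ[ℝ] ℝ}

/-- The surface measure on the hyperplane that contains the side opposite the vertex `v`. -/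
noncomputable def sideMeasure (K : Finset (E d)) (v : E d) : Measure (E d) :=
  planeMeasure (normal K (K.erase v)) (barycenter (K.erase v))

namespace IsBary

lemma inner_sub_barycenter_eq_zero_iff (h : IsBary K lam) (hcard : K.card = d + 1) (hd : 0 < d)
    {v : E d} (hv : v ∈ K) (x : E d) :
    inner ℝ (normal K (K.erase v)) (x - barycenter (K.erase v)) = 0 ↔ lam v x = 0 := by
  obtain ⟨-, h2, h3⟩ := h.normal_height hcard hd hv
  rw [inner_sub_right, h3 x]
  constructor
  · intro h0
    have : height K v * lam v x = 0 := by linarith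
    exact (mul_eq_zero.1 this).resolve_left h2.ne'
  · intro h0
    rw [h0]; ring

lemma sideMeasure_eq (h : IsBary K lam) (hcard : K.card = d + 1) (hd : 0 < d)
    {v : E d} (hv : v ∈ K) :
    sideMeasure K v
      = (Measure.euclideanHausdorffMeasure (d - 1)).restrict {x | lam v x = 0} := by
  rw [sideMeasure, planeMeasure]
  simp_rw [h.inner_sub_barycenter_eq_zero_iff hcard hd hv]

/-- A need agree with the side only on its hyperplane. This allows one cylinder to serve for two
different sides in `integral_fderiv_edge`. -/
lemma restrict_sideMeasure (h : IsBary K lam) (hcard : K.card = d + 1) (hd : 0 < d)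
    {v : E d} (hv : v ∈ K) {A : Set (E d)} (hA : MeasurableSet A)
    (hAs : ∀ x, lam v x = 0 → (x ∈ A ↔ x ∈ simplex (K.erase v))) :
    (sideMeasure K v).restrict A
      = (Measure.euclideanHausdorffMeasure (d - 1)).restrict (simplex (K.erase v)) := by
  rw [h.sideMeasure_eq hcard hd hv, Measure.restrict_restrict hA]
  congr 1
  ext x
  simp only [Set.mem_inter_iff, Set.mem_ofPred_eq]
  constructor
  · rintro ⟨h1, h2⟩
    exact (hAs x h2).1 h1
  · intro hx
    have h2 := ((h.mem_side_iff hv).1 hx).2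
    exact ⟨(hAs x h2).2 hx, h2⟩

lemma integrableOn_side (h : IsBary K lam) (hcard : K.card = d + 1) (hd : 0 < d)
    {v : E d} (hv : v ∈ K) {f : E d → ℝ} (hf : ContinuousOn f (simplex (K.erase v))) :
    IntegrableOn f (simplex (K.erase v)) (Measure.euclideanHausdorffMeasure (d - 1)) := by
  have hc := isCompact_simplex (K.erase v)
  have h1 := h.restrict_sideMeasure hcard hd hv (A := simplex (K.erase v)) hc.measurableSet
    (fun x _ => Iff.rfl)
  have hlt : sideMeasure K v (simplex (K.erase v)) < ∞ :=
    planeMeasure_lt_top (h.normal_height hcard hd hv).1 _ hc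
  have hlt' : Measure.euclideanHausdorffMeasure (d - 1) (simplex (K.erase v)) < ∞ := by
    have h2 := congrArg (fun μ => μ Set.univ) h1
    simp only [Measure.restrict_apply_univ] at h2
    rwa [← h2]
  obtain ⟨C, hC⟩ := hc.exists_bound_of_continuousOn hf
  exact IntegrableOn.of_bound hlt' (hf.aestronglyMeasurable hc.measurableSet) C
    ((ae_restrict_iff' hc.measurableSet).2 (ae_of_all _ hC))

/-- The divergence theorem for the constant direction of an edge of the simplex. -/
lemma integral_fderiv_edge (h : IsBary K lam) (hcard : K.card = d + 1) (hd : 0 < d)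
    {a b : E d} (ha : a ∈ K) (hb : b ∈ K) (hab : a ≠ b) {f : E d → ℝ} (hf : ContDiff ℝ 1 f) :
    ∫ x in simplex K, fderiv ℝ f x (a - b)
      = height K b * sideInt (K.erase b) f - height K a * sideInt (K.erase a) f := by
  obtain ⟨hna, hHa, -⟩ := h.normal_height hcard hd ha
  obtain ⟨hnb, hHb, -⟩ := h.normal_height hcard hd hb
  set w := a - b with hw
  have hla : (lam a).linear w = 1 := by
    rw [h.linear_sub, h.self a ha, h.other a ha b hb hab.symm, sub_zero]
  have hlb : (lam b).linear w = -1 := by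
    rw [h.linear_sub, h.self b hb, h.other b hb a ha hab, zero_sub]
  -- Along the edge direction only `lam a` and `lam b` vary; every other side is parallel to w and
  -- carries no flux.
  have hlo : ∀ u ∈ K, u ≠ a → u ≠ b → (lam u).linear w = 0 := by
    intro u hu hua hub
    rw [h.linear_sub, h.other u hu a ha hua.symm, h.other u hu b hb hub.symm, sub_zero]
  have hia : inner ℝ (normal K (K.erase a)) w = - height K a := by
    rw [h.inner_normal hcard hd ha, hla, mul_one]
  have hib : inner ℝ (normal K (K.erase b)) w = height K b := by
    rw [h.inner_normal hcard hd hb, hlb]; ring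
  have hcont := continuous lam
  have hsf : SFinite (sideMeasure K b) := sFinite_planeMeasure hnb _
  -- the cylinder over the simplex
  let A : Set (E d) := {x | (∀ u ∈ K, u ≠ a → u ≠ b → 0 ≤ lam u x) ∧ 0 ≤ lam a x + lam b x}
  have hAclosed : IsClosed A := by
    have h1 : IsClosed {x : E d | ∀ u ∈ K, u ≠ a → u ≠ b → 0 ≤ lam u x} := by
      simp only [Set.ofPred_forall]
      exact isClosed_iInter fun u => isClosed_iInter fun _ => isClosed_iInter fun _ =>
        isClosed_iInter fun _ => isClosed_le continuous_const (hcont u)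
    exact h1.inter (isClosed_le continuous_const ((hcont a).add (hcont b)))
  have hA := hAclosed.measurableSet
  have hAinv : ∀ x (t : ℝ), x + t • w ∈ A ↔ x ∈ A := by
    intro x t
    have h1 : ∀ u ∈ K, u ≠ a → u ≠ b → lam u (x + t • w) = lam u x := by
      intro u hu hua hub
      rw [add_smul, hlo u hu hua hub, mul_zero, add_zero]
    have h2 : lam a (x + t • w) + lam b (x + t • w) = lam a x + lam b x := by
      rw [add_smul, add_smul, hla, hlb]; ring
    change (_ ∧ _) ↔ (_ ∧ _)
    rw [h2]
    refine and_congr_left fun _ => ?_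
    constructor
    · intro hx u hu hua hub
      rw [← h1 u hu hua hub]; exact hx u hu hua hub
    · intro hx u hu hua hub
      rw [h1 u hu hua hub]; exact hx u hu hua hub
  have hKA : ∀ x, x ∈ simplex K ↔ x ∈ A ∧ 0 ≤ lam a x ∧ 0 ≤ lam b x := by
    intro x
    rw [h.mem_simplex_iff]
    constructor
    · intro hx
      exact ⟨⟨fun u hu _ _ => hx u hu, add_nonneg (hx a ha) (hx b hb)⟩, hx a ha, hx b hb⟩
    · rintro ⟨⟨h1, -⟩, h2, h3⟩ u hu
      by_cases hua : u = a
      · rwa [hua]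
      by_cases hub : u = b
      · rwa [hub]
      exact h1 u hu hua hub
  have hAb : ∀ x, lam b x = 0 → (x ∈ A ↔ x ∈ simplex (K.erase b)) := by
    intro x hx
    rw [h.mem_side_iff hb, hKA, hx]
    refine ⟨fun hxA => ⟨⟨hxA, ?_, le_rfl⟩, rfl⟩, fun h' => h'.1.1⟩
    have := hxA.2
    rwa [hx, add_zero] at this
  have hAa : ∀ x, lam a x = 0 → (x ∈ A ↔ x ∈ simplex (K.erase a)) := by
    intro x hx
    rw [h.mem_side_iff ha, hKA, hx]
    refine ⟨fun hxA => ⟨⟨hxA, le_rfl, ?_⟩, rfl⟩, fun h' => h'.1.1⟩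
    have := hxA.2
    rwa [hx, zero_add] at this
  have hrb := h.restrict_sideMeasure hcard hd hb hA hAb
  have hra := h.restrict_sideMeasure hcard hd ha hA hAa
  -- the integral over the lines
  let g : E d → ℝ := fun x => fderiv ℝ f x w
  have hg : Continuous g := (hf.continuous_fderiv one_ne_zero).clm_apply continuous_const
  have hKc := isCompact_simplex K
  let F : E d → ℝ := (simplex K).indicator g
  have hF : Integrable F := (integrable_indicator_iff hKc.measurableSet).2
    (hg.continuousOn.integrableOn_compact hKc)
  -- Volume is disintegrated along lines through the hyperplane of the side opposite b; the Jacobian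
  -- is the height over that side.
  have hmap := map_lines_planeMeasure hnb (barycenter (K.erase b)) (w := w)
    (by rw [hib]; exact hHb.ne')
  rw [hib, abs_of_pos hHb] at hmap
  change Measure.map _ (volume.prod (sideMeasure K b)) = _ at hmap
  have hF2 : Integrable F (Measure.map (fun z : ℝ × E d => z.2 + z.1 • w)
      (volume.prod (sideMeasure K b))) := by
    rw [hmap]
    exact hF.smul_measure ENNReal.ofReal_ne_top
  have hF3 : Integrable (fun z : ℝ × E d => F (z.2 + z.1 • w))
      (volume.prod (sideMeasure K b)) := hF2.comp_measurable (by fun_prop)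
  have hint : ∫ x, F x = height K b * ∫ x, (∫ t : ℝ, F (x + t • w)) ∂(sideMeasure K b) := by
    have h1 := integral_map (μ := volume.prod (sideMeasure K b))
      (φ := fun z : ℝ × E d => z.2 + z.1 • w) (by fun_prop) hF2.aestronglyMeasurable
    rw [hmap, integral_smul_measure, integral_prod_symm _ hF3,
      ENNReal.toReal_ofReal (inv_nonneg.2 hHb.le)] at h1
    rw [← h1, smul_eq_mul, ← mul_assoc, mul_inv_cancel₀ hHb.ne', one_mul]
  -- Moving along w raises `lam a` and lowers `lam b` at unit rate, so a line in the cylinder meets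
  -- the simplex for t from -`lam a x` to `lam b x`. The fundamental theorem of calculus leaves the
  -- two endpoint values, one on each side.
  have hline : ∀ x, ∫ t : ℝ, F (x + t • w)
      = A.indicator (fun x => f (x + lam b x • w)) x
        - A.indicator f (x - lam a x • w) := by
    intro x
    have hinv2 : x - lam a x • w ∈ A ↔ x ∈ A := by
      have := hAinv x (- lam a x)
      rwa [neg_smul, ← sub_eq_add_neg] at this
    have hmemK : ∀ t : ℝ, x + t • w ∈ simplex K ↔ x ∈ A ∧ t ∈ Set.Icc (-lam a x) (lam b x) := by
      intro t
      rw [hKA, hAinv, add_smul, add_smul, hla, hlb, Set.mem_Icc]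
      refine and_congr_right fun _ => ?_
      constructor <;> rintro ⟨h1, h2⟩ <;> constructor <;> linarith
    by_cases hx : x ∈ A
    · rw [Set.indicator_of_mem hx, Set.indicator_of_mem (hinv2.2 hx)]
      have h1 : (fun t : ℝ => F (x + t • w))
          = (Set.Icc (-lam a x) (lam b x)).indicator (fun t => g (x + t • w)) := by
        ext t
        by_cases ht : t ∈ Set.Icc (-lam a x) (lam b x)
        · rw [Set.indicator_of_mem ht]
          exact Set.indicator_of_mem ((hmemK t).2 ⟨hx, ht⟩) _
        · rw [Set.indicator_of_notMem ht]
          exact Set.indicator_of_notMem (fun h' => ht ((hmemK t).1 h').2) _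
      rw [h1, integral_indicator measurableSet_Icc, integral_Icc_eq_integral_Ioc,
        ← intervalIntegral.integral_of_le (by have := hx.2; linarith)]
      rw [intervalIntegral.integral_eq_sub_of_hasDerivAt (f := fun t : ℝ => f (x + t • w))]
      · rw [neg_smul, ← sub_eq_add_neg]
      · intro t _
        have h2 : HasDerivAt (fun t : ℝ => x + t • w) w t := by
          simpa using ((hasDerivAt_id t).smul_const w).const_add x
        exact ((hf.differentiable one_ne_zero).differentiableAt.hasFDerivAt).comp_hasDerivAt t h2
      · exact (hg.comp (by fun_prop)).intervalIntegrable _ _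
    · rw [Set.indicator_of_notMem hx, Set.indicator_of_notMem (fun h' => hx (hinv2.1 h')), sub_zero]
      have h1 : (fun t : ℝ => F (x + t • w)) = fun _ => 0 := by
        ext t
        exact Set.indicator_of_notMem (fun h' => hx ((hmemK t).1 h').1) _
      rw [h1, integral_zero]
  -- the contribution of the side opposite `b`
  have hae : (fun x => A.indicator (fun x => f (x + lam b x • w)) x)
      =ᵐ[sideMeasure K b] A.indicator f := by
    rw [h.sideMeasure_eq hcard hd hb]
    refine (ae_restrict_iff' ?_).2 (ae_of_all _ fun x hx => ?_)
    · exact (isClosed_eq (hcont b) continuous_const).measurableSet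
    · have hx' : lam b x = 0 := hx
      beta_reduce
      by_cases hxA : x ∈ A
      · rw [Set.indicator_of_mem hxA, Set.indicator_of_mem hxA, hx', zero_smul, add_zero]
      · rw [Set.indicator_of_notMem hxA, Set.indicator_of_notMem hxA]
  have hintb : Integrable (A.indicator f) (sideMeasure K b) := by
    rw [integrable_indicator_iff hA, IntegrableOn, hrb]
    exact h.integrableOn_side hcard hd hb hf.continuous.continuousOn
  have hinta : Integrable (A.indicator f) (sideMeasure K a) := by
    rw [integrable_indicator_iff hA, IntegrableOn, hra]
    exact h.integrableOn_side hcard hd ha hf.continuous.continuousOn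
  -- the contribution of the side opposite `a`
  have hproj := map_proj_planeMeasure hnb hna (barycenter (K.erase b)) (barycenter (K.erase a))
    (w := w) (by rw [hib]; exact hHb.ne') (by rw [hia]; exact neg_ne_zero.2 hHa.ne') (lam a)
    (hcont a) (fun x t => by rw [add_smul, hla, mul_one])
    (fun x hx => (h.inner_sub_barycenter_eq_zero_iff hcard hd ha x).1 hx)
  rw [hib, hia, abs_neg, abs_of_pos hHa, abs_of_pos hHb] at hproj
  change ENNReal.ofReal (height K b) • Measure.map _ (sideMeasure K b)
    = ENNReal.ofReal (height K a) • sideMeasure K a at hproj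
  have hmeas : Measurable (fun x => x - lam a x • w) := by
    have := (hcont a).measurable
    fun_prop
  have hintm : Integrable (A.indicator f)
      (Measure.map (fun x => x - lam a x • w) (sideMeasure K b)) := by
    have h1 : Integrable (A.indicator f) (ENNReal.ofReal (height K b) •
        Measure.map (fun x => x - lam a x • w) (sideMeasure K b)) := by
      rw [hproj]
      exact hinta.smul_measure ENNReal.ofReal_ne_top
    exact (integrable_smul_measure (by simpa using hHb) ENNReal.ofReal_ne_top).1 h1
  have hintp : Integrable (fun x => A.indicator f (x - lam a x • w)) (sideMeasure K b) :=
    hintm.comp_measurable hmeas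
  have hinteq : height K b * ∫ x, A.indicator f (x - lam a x • w) ∂(sideMeasure K b)
      = height K a * ∫ x, A.indicator f x ∂(sideMeasure K a) := by
    have h1 := congrArg (fun μ => ∫ x, A.indicator f x ∂μ) hproj
    simp only [integral_smul_measure, ENNReal.toReal_ofReal hHb.le, ENNReal.toReal_ofReal hHa.le,
      smul_eq_mul] at h1
    rwa [integral_map hmeas.aemeasurable hintm.aestronglyMeasurable] at h1
  have hlhs : ∫ x in simplex K, fderiv ℝ f x w = ∫ x, F x :=
    (integral_indicator hKc.measurableSet).symm
  rw [hlhs, hint]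
  simp_rw [hline]
  rw [integral_sub (hintb.congr hae.symm) hintp, integral_congr_ae hae, mul_sub, hinteq,
    integral_indicator hA, integral_indicator hA, hrb, hra]
  rfl

/-- The divergence theorem for a constant direction. -/
lemma integral_fderiv (h : IsBary K lam) (hcard : K.card = d + 1) (hd : 0 < d)
    {f : E d → ℝ} (hf : ContDiff ℝ 1 f) (w : E d) :
    ∫ x in simplex K, fderiv ℝ f x w
      = ∑ v ∈ K, inner ℝ (normal K (K.erase v)) w * sideInt (K.erase v) f := by
  obtain ⟨o, ho⟩ : K.Nonempty := by rw [← Finset.card_pos, hcard]; omega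
  -- Expanding w in edges from one vertex o reduces to the edge case. The coefficients sum to zero,
  -- so the contributions of the side opposite o coming from the individual edges cancel except for
  -- its own term.
  have hw : w = ∑ v ∈ K, (lam v).linear w • (v - o) := by
    simp_rw [smul_sub, Finset.sum_sub_distrib, ← Finset.sum_smul, h.sum_linear, h.sum_linear_smul]
    simp
  have hedge : ∀ v ∈ K, ∫ x in simplex K, fderiv ℝ f x (v - o)
      = height K o * sideInt (K.erase o) f - height K v * sideInt (K.erase v) f := by
    intro v hv
    by_cases hvo : v = o
    · subst hvo; simp
    · exact h.integral_fderiv_edge hcard hd hv ho hvo hf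
  have hi : ∀ u : E d, IntegrableOn (fun x => fderiv ℝ f x u) (simplex K) := fun u =>
    ((hf.continuous_fderiv one_ne_zero).clm_apply continuous_const).continuousOn.integrableOn_compact
      (isCompact_simplex K)
  have h1 : ∀ x, fderiv ℝ f x w = ∑ v ∈ K, (lam v).linear w * fderiv ℝ f x (v - o) := by
    intro x
    conv_lhs => rw [hw]
    simp [map_sum, map_smul]
  simp_rw [h1]
  rw [integral_finsetSum _ (fun v _ => (hi (v - o)).const_mul _)]
  simp_rw [integral_const_mul]
  rw [Finset.sum_congr rfl (fun v hv => by rw [hedge v hv])]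
  simp_rw [mul_sub, Finset.sum_sub_distrib, ← Finset.sum_mul, h.sum_linear, zero_mul, zero_sub]
  rw [← Finset.sum_neg_distrib]
  refine Finset.sum_congr rfl fun v hv => ?_
  rw [h.inner_normal hcard hd hv]
  ring

end IsBary

lemma continuous_divergence {X : E d → E d} (hX : ContDiff ℝ 1 X) : Continuous (divergence X) := by
  unfold divergence
  refine continuous_finsetSum _ fun i _ => ?_
  exact (EuclideanSpace.proj (𝕜 := ℝ) i).continuous.comp
    ((hX.continuous_fderiv one_ne_zero).clm_apply continuous_const)

/-- The divergence theorem on a simplex. -/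
theorem integral_divergence (hK : AffineIndependent ℝ ((↑) : K → E d)) (hcard : K.card = d + 1)
    (hd : 0 < d) {X : E d → E d} (hX : ContDiff ℝ 1 X) :
    ∫ x in simplex K, divergence X x
      = ∑ e ∈ sides K, sideInt e (fun x => inner ℝ (X x) (normal K e)) := by
  obtain ⟨lam, h⟩ := exists_isBary hK hcard
  have hXi : ∀ i, ContDiff ℝ 1 (fun x => X x i) := fun i =>
    (EuclideanSpace.proj (𝕜 := ℝ) i).contDiff.comp hX
  have hdi : ∀ x i, fderiv ℝ X x (EuclideanSpace.single i 1) i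
      = fderiv ℝ (fun x => X x i) x (EuclideanSpace.single i 1) := by
    intro x i
    have h1 := ((EuclideanSpace.proj (𝕜 := ℝ) i).hasFDerivAt (x := X x)).comp x
      ((hX.differentiable one_ne_zero) x).hasFDerivAt
    have h2 : fderiv ℝ (fun x => X x i) x = _ := h1.fderiv
    rw [h2]
    rfl
  have hi : ∀ i, IntegrableOn (fun x => fderiv ℝ (fun x => X x i) x (EuclideanSpace.single i 1))
      (simplex K) := fun i =>
    (((hXi i).continuous_fderiv one_ne_zero).clm_apply
      continuous_const).continuousOn.integrableOn_compact (isCompact_simplex K)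
  unfold divergence
  simp_rw [hdi]
  rw [integral_finsetSum _ (fun i _ => hi i), sum_sides hcard]
  simp_rw [h.integral_fderiv hcard hd (hXi _)]
  rw [Finset.sum_comm]
  refine Finset.sum_congr rfl fun v hv => ?_
  unfold sideInt
  simp_rw [← integral_const_mul]
  rw [← integral_finsetSum]
  · refine integral_congr_ae (ae_of_all _ fun x => ?_)
    simp [PiLp.inner_apply]
  · intro i _
    exact (h.integrableOn_side hcard hd hv (hXi i).continuous.continuousOn).const_mul _

end Divergence

/-! ### Polynomials of bounded degree -/

section Polys

variable {d k : ℕ}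

/-- The polynomials of degree at most `k` as a space of functions. -/
noncomputable def polySpace (d k : ℕ) : Submodule ℝ (E d → ℝ) :=
  (MvPolynomial.restrictTotalDegree (Fin d) ℝ k).map
    (LinearMap.pi fun x : E d =>
      (MvPolynomial.aeval (R := ℝ) (fun i => x i)).toLinearMap)

lemma mem_polySpace {f : E d → ℝ} : f ∈ polySpace d k ↔ f ∈ polys d k := by
  simp only [polySpace, Submodule.mem_map, MvPolynomial.mem_restrictTotalDegree, polys,
    Set.mem_ofPred_eq]
  refine exists_congr fun p => and_congr_right fun _ => ?_
  rw [funext_iff]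
  refine forall_congr' fun x => ?_
  simp only [LinearMap.pi_apply, AlgHom.toLinearMap_apply, MvPolynomial.aeval_eq_eval]
  exact eq_comm

instance : FiniteDimensional ℝ (polySpace d k) := by
  unfold polySpace
  infer_instance

lemma const_mem_polys (c : ℝ) : (fun _ => c) ∈ polys d k :=
  ⟨MvPolynomial.C c, by simp, by simp⟩

lemma zero_mem_polys : (fun _ => 0) ∈ polys d k := const_mem_polys 0

lemma analyticOnNhd_of_mem_polys {f : E d → ℝ} (hf : f ∈ polys d k) :
    AnalyticOnNhd ℝ f Set.univ := by
  obtain ⟨p, -, hp⟩ := hf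
  have : f = fun x => MvPolynomial.eval (fun i => x i) p := funext hp
  rw [this]
  clear hp this
  induction p using MvPolynomial.induction_on with
  | C a => simpa using analyticOnNhd_const
  | add p q hp hq =>
    simp only [map_add]
    exact hp.add hq
  | mul_X p i hp =>
    simpa using hp.mul ((EuclideanSpace.proj (𝕜 := ℝ) i).analyticOnNhd Set.univ)

lemma contDiff_of_mem_polys {f : E d → ℝ} (hf : f ∈ polys d k) {n : WithTop ℕ∞} :
    ContDiff ℝ n f :=
  contDiffOn_univ.1 ((analyticOnNhd_of_mem_polys hf).contDiffOn uniqueDiffOn_univ)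

lemma continuous_of_mem_polys {f : E d → ℝ} (hf : f ∈ polys d k) : Continuous f :=
  (contDiff_of_mem_polys (n := 1) hf).continuous

lemma contDiff_of_mem_vecPolys {q : E d → E d} (hq : q ∈ vecPolys d k) {n : WithTop ℕ∞} :
    ContDiff ℝ n q :=
  contDiff_euclidean.2 fun i => contDiff_of_mem_polys (hq i)

lemma polys_comp_homothety {f : E d → ℝ} (hf : f ∈ polys d k) (c : E d) (r : ℝ) :
    (fun y => f (c + r • y)) ∈ polys d k := by
  obtain ⟨p, hp, hpf⟩ := hf
  let A : Fin d → MvPolynomial (Fin d) ℝ := fun i => .C (c i) + .C r * .X i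
  have hA : ∀ i, (A i).totalDegree ≤ 1 := by
    intro i
    refine (MvPolynomial.totalDegree_add _ _).trans (max_le (by simp) ?_)
    refine (MvPolynomial.totalDegree_mul _ _).trans ?_
    simp
  refine ⟨MvPolynomial.bind₁ A p, ?_, ?_⟩
  · rw [MvPolynomial.bind₁, MvPolynomial.aeval_def, MvPolynomial.eval₂_eq]
    refine MvPolynomial.totalDegree_finsetSum_le fun m hm => ?_
    refine (MvPolynomial.totalDegree_mul _ _).trans ?_
    rw [MvPolynomial.algebraMap_eq, MvPolynomial.totalDegree_C, zero_add]
    refine (MvPolynomial.totalDegree_finsetProd _ _).trans ?_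
    refine le_trans ?_ ((MvPolynomial.le_totalDegree hm).trans hp)
    rw [Finsupp.sum]
    refine Finset.sum_le_sum fun i _ => ?_
    refine (MvPolynomial.totalDegree_pow _ _).trans ?_
    calc m i * (A i).totalDegree ≤ m i * 1 := Nat.mul_le_mul_left _ (hA i)
      _ = m i := mul_one _
  · intro y
    beta_reduce
    rw [hpf, ← MvPolynomial.aeval_eq_eval, ← MvPolynomial.aeval_eq_eval,
      MvPolynomial.aeval_bind₁]
    congr 2
    ext i
    simp [A]

lemma totalDegree_pderiv_le (p : MvPolynomial (Fin d) ℝ) (i : Fin d) :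
    (MvPolynomial.pderiv i p).totalDegree ≤ p.totalDegree := by
  refine Finset.sup_le fun m hm => ?_
  rw [MvPolynomial.mem_support_iff, MvPolynomial.coeff_pderiv] at hm
  have h1 : m + Finsupp.single i 1 ∈ p.support :=
    MvPolynomial.mem_support_iff.2 (left_ne_zero_of_mul hm)
  have h2 := MvPolynomial.le_totalDegree h1
  rw [Finsupp.sum_add_index' (by simp) (by simp)] at h2
  exact le_trans (Nat.le_add_right _ _) h2

lemma fderiv_mem_polys {f : E d → ℝ} (hf : f ∈ polys d k) (i : Fin d) :
    (fun x => fderiv ℝ f x (EuclideanSpace.single i 1)) ∈ polys d k := by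
  obtain ⟨p, hp, hpf⟩ := hf
  refine ⟨MvPolynomial.pderiv i p, (totalDegree_pderiv_le p i).trans hp, ?_⟩
  have : f = fun x => MvPolynomial.eval (fun i => x i) p := funext hpf
  rw [this]
  clear hpf this hp
  intro x
  have hdiff : ∀ p : MvPolynomial (Fin d) ℝ,
      DifferentiableAt ℝ (fun x : E d => MvPolynomial.eval (fun i => x i) p) x := fun p =>
    (contDiff_of_mem_polys (k := p.totalDegree) ⟨p, le_rfl, fun _ => rfl⟩
      (n := 1)).differentiable one_ne_zero x
  induction p using MvPolynomial.induction_on with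
  | C a => simp
  | add p q hp hq =>
    simp only [map_add] at hp hq ⊢
    rw [fderiv_fun_add (hdiff p) (hdiff q), add_apply, hp, hq]
  | mul_X p j hp =>
    have hj : HasFDerivAt (fun x : E d => x j) (EuclideanSpace.proj (𝕜 := ℝ) j : E d →L[ℝ] ℝ) x :=
      (EuclideanSpace.proj (𝕜 := ℝ) j).hasFDerivAt
    simp only [map_mul, MvPolynomial.eval_X, Derivation.leibniz, map_add, smul_eq_mul]
    rw [fderiv_fun_mul (hdiff p) hj.differentiableAt, hj.fderiv]
    simp only [add_apply, smul_apply, hp, smul_eq_mul]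
    simp [MvPolynomial.pderiv_X, Pi.single_apply, apply_ite, eq_comm]

/-- This makes the divergence of q an admissible test function for the orthogonality of f - p. -/
lemma divergence_mem_polys {q : E d → E d} (hq : q ∈ vecPolys d k) :
    divergence q ∈ polys d k := by
  have h1 : divergence q
      = ∑ i, fun x => fderiv ℝ (fun x => q x i) x (EuclideanSpace.single i 1) := by
    ext x
    rw [Finset.sum_apply]
    refine Finset.sum_congr rfl fun i _ => ?_
    have h1 := ((EuclideanSpace.proj (𝕜 := ℝ) i).hasFDerivAt (x := q x)).comp x
      ((contDiff_of_mem_vecPolys (n := 1) hq).differentiable one_ne_zero x).hasFDerivAt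
    have h2 : fderiv ℝ (fun x => q x i) x = _ := h1.fderiv
    rw [h2]
    rfl
  rw [h1, ← mem_polySpace]
  exact Submodule.sum_mem _ fun i _ => mem_polySpace.2 (fderiv_mem_polys (hq i) i)

/-! ### Least squares approximation and the inverse inequality -/

lemma memLp_of_continuous {s : Set (E d)} (hs : IsCompact s) {F : Type*}
    [NormedAddCommGroup F] {f : E d → F} (hf : Continuous f) :
    MemLp f 2 (volume.restrict s) := by
  obtain ⟨C, hC⟩ := hs.exists_bound_of_continuousOn hf.continuousOn
  have : IsFiniteMeasure (volume.restrict s) := ⟨by simpa using hs.measure_lt_top⟩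
  exact MemLp.of_bound (hf.continuousOn.aestronglyMeasurable_of_isCompact hs hs.measurableSet) C
    ((ae_restrict_iff' hs.measurableSet).2 (ae_of_all _ hC))

lemma continuous_polySpace (f : polySpace d k) : Continuous (f : E d → ℝ) :=
  continuous_of_mem_polys (mem_polySpace.1 f.2)

/-- Polynomials as elements of `L²(s)` for a compact set `s`. -/
noncomputable def polyToLp (k : ℕ) {s : Set (E d)} (hs : IsCompact s) :
    polySpace d k →ₗ[ℝ] Lp ℝ 2 (volume.restrict s) where
  toFun f := (memLp_of_continuous hs (continuous_polySpace f)).toLp _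
  map_add' _ _ := MemLp.toLp_add _ _
  map_smul' _ _ := MemLp.toLp_const_smul _ _

lemma inner_toLp {s : Set (E d)} {f g : E d → ℝ} (hf : MemLp f 2 (volume.restrict s))
    (hg : MemLp g 2 (volume.restrict s)) :
    inner ℝ (hf.toLp f) (hg.toLp g) = ∫ x in s, f x * g x := by
  rw [L2.inner_def]
  refine integral_congr_ae ?_
  filter_upwards [hf.coeFn_toLp, hg.coeFn_toLp] with x h1 h2
  rw [h1, h2]
  simp [mul_comm]

/-- The orthogonal projection onto polynomials in `L²(s)`. -/
lemma exists_projection (k : ℕ) {s : Set (E d)} (hs : IsCompact s) {f : E d → ℝ}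
    (hf : Continuous f) :
    ∃ p ∈ polys d k, ∀ r ∈ polys d k, ∫ x in s, (f x - p x) * r x = 0 := by
  set S := LinearMap.range (polyToLp (d := d) k hs) with hS
  have hfm := memLp_of_continuous hs hf
  obtain ⟨p, hp⟩ := LinearMap.mem_range.1 (S.starProjection_apply_mem (hfm.toLp f))
  refine ⟨p, mem_polySpace.1 p.2, fun r hr => ?_⟩
  have h1 := S.starProjection_inner_eq_zero (hfm.toLp f)
    (polyToLp (d := d) k hs ⟨r, mem_polySpace.2 hr⟩) ⟨_, rfl⟩
  rw [← hp] at h1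
  have h2 : hfm.toLp f - polyToLp k hs p
      = (hfm.sub (memLp_of_continuous hs (continuous_polySpace p))).toLp _ :=
    (MemLp.toLp_sub hfm (memLp_of_continuous hs (continuous_polySpace p))).symm
  rw [h2] at h1
  exact (inner_toLp _ (memLp_of_continuous hs (continuous_of_mem_polys hr))).symm.trans h1

/-- A polynomial that vanishes almost everywhere on s vanishes on the interior by continuity, and
then everywhere by analytic continuation. -/
lemma polyToLp_injective (k : ℕ) {s : Set (E d)} (hs : IsCompact s)
    (hne : (interior s).Nonempty) : Function.Injective (polyToLp (d := d) k hs) := by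
  rw [← LinearMap.ker_eq_bot, LinearMap.ker_eq_bot']
  intro f hf
  have h1 : (f : E d → ℝ) =ᵐ[volume.restrict s] 0 := by
    have h2 : (memLp_of_continuous hs (continuous_polySpace f)).toLp _ = 0 := hf
    exact (MemLp.coeFn_toLp _).symm.trans ((Lp.eq_zero_iff_ae_eq_zero).1 h2)
  have h2 : (f : E d → ℝ) =ᵐ[volume.restrict (interior s)] 0 :=
    ae_restrict_of_ae_restrict_of_subset interior_subset h1
  have h3 : Set.EqOn (f : E d → ℝ) 0 (interior s) :=
    Measure.eqOn_open_of_ae_eq h2 isOpen_interior (continuous_polySpace f).continuousOn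
      continuousOn_const
  obtain ⟨x, hx⟩ := hne
  have h4 : (f : E d → ℝ) =ᶠ[𝓝 x] 0 := by
    filter_upwards [isOpen_interior.mem_nhds hx] with y hy using h3 hy
  have h5 := (analyticOnNhd_of_mem_polys (mem_polySpace.1 f.2)).eq_of_eventuallyEq
    (analyticOnNhd_const (v := (0 : ℝ))) h4
  exact Subtype.ext h5

/-- The derivative of a polynomial is bounded by its `L²` norm on the unit ball. -/
lemma exists_fderiv_bound (d k : ℕ) (R : ℝ) :
    ∃ C : ℝ, 0 ≤ C ∧ ∀ f ∈ polys d k, ∀ x : E d, ‖x‖ ≤ R →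
      ‖fderiv ℝ f x‖ ^ 2 ≤ C * ∫ y in Metric.closedBall (0 : E d) 1, f y ^ 2 := by
  have hs := isCompact_closedBall (0 : E d) 1
  let b := Module.finBasis ℝ (polySpace d k)
  let T := (polyToLp (d := d) k hs).comp b.equivFun.symm.toLinearMap
  have hT : LinearMap.ker T = ⊥ := by
    rw [LinearMap.ker_eq_bot]
    refine (polyToLp_injective k hs ?_).comp b.equivFun.symm.injective
    exact ⟨0, Metric.ball_subset_interior_closedBall (by simp)⟩
  -- Equivalence of norms in finite dimension: the coefficients in a fixed basis are bounded by the
  -- `L²` norm on the unit ball, and the basis gradients are bounded on the ball of radius R.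
  obtain ⟨A, -, hA⟩ := T.exists_antilipschitzWith hT
  have hbc : ∀ i, ContDiff ℝ 1 (b i : E d → ℝ) := fun i =>
    contDiff_of_mem_polys (mem_polySpace.1 (b i).2)
  have hcont : Continuous fun x => ∑ i, ‖fderiv ℝ (b i : E d → ℝ) x‖ :=
    continuous_finsetSum _ fun i _ => ((hbc i).continuous_fderiv one_ne_zero).norm
  obtain ⟨M, hM⟩ := (isCompact_closedBall (0 : E d) R).exists_bound_of_continuousOn
    hcont.continuousOn
  refine ⟨(M * A) ^ 2, sq_nonneg _, fun f hf x hx => ?_⟩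
  let c := b.equivFun ⟨f, mem_polySpace.2 hf⟩
  have hTc : ‖T c‖ ^ 2 = ∫ y in Metric.closedBall (0 : E d) 1, f y ^ 2 := by
    have h1 : T c = (memLp_of_continuous hs (continuous_of_mem_polys hf)).toLp f := by
      simp only [T, c, LinearMap.comp_apply, LinearEquiv.coe_coe, LinearEquiv.symm_apply_apply]
      rfl
    rw [h1, ← real_inner_self_eq_norm_sq, inner_toLp]
    simp_rw [sq]
  have hc : ‖c‖ ≤ A * ‖T c‖ := by
    have h1 := hA.le_mul_dist c 0
    simpa [dist_eq_norm] using h1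
  have hfs : f = fun y => ∑ i, c i * (b i : E d → ℝ) y := by
    have h1 := congrArg (fun g : polySpace d k => (g : E d → ℝ))
      (b.sum_equivFun ⟨f, mem_polySpace.2 hf⟩)
    simp only [Submodule.coe_sum, Submodule.coe_smul] at h1
    rw [← h1]
    ext y
    simp [c]
  have hd : fderiv ℝ f x = ∑ i, c i • fderiv ℝ (b i : E d → ℝ) x := by
    have hdi : ∀ i, DifferentiableAt ℝ (b i : E d → ℝ) x := fun i =>
      (hbc i).differentiable one_ne_zero x
    conv_lhs => rw [hfs]
    rw [fderiv_fun_sum fun i _ => (hdi i).const_mul (c i)]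
    exact Finset.sum_congr rfl fun i _ => fderiv_const_mul (hdi i) (c i)
  have hMx := hM x (by simpa using hx)
  have hM0 : 0 ≤ M := (norm_nonneg _).trans hMx
  have h1 : ‖fderiv ℝ f x‖ ≤ ‖c‖ * M := by
    rw [hd]
    calc ‖∑ i, c i • fderiv ℝ (b i : E d → ℝ) x‖
        ≤ ∑ i, ‖c i • fderiv ℝ (b i : E d → ℝ) x‖ := norm_sum_le _ _
      _ ≤ ∑ i, ‖c‖ * ‖fderiv ℝ (b i : E d → ℝ) x‖ := by
          refine Finset.sum_le_sum fun i _ => ?_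
          rw [norm_smul]
          exact mul_le_mul_of_nonneg_right (norm_le_pi_norm c i) (norm_nonneg _)
      _ = ‖c‖ * ∑ i, ‖fderiv ℝ (b i : E d → ℝ) x‖ := by rw [Finset.mul_sum]
      _ ≤ ‖c‖ * M := mul_le_mul_of_nonneg_left ((le_abs_self _).trans hMx) (norm_nonneg _)
  have h2 : ‖fderiv ℝ f x‖ ≤ M * A * ‖T c‖ := by
    refine h1.trans ?_
    calc ‖c‖ * M ≤ (A * ‖T c‖) * M := mul_le_mul_of_nonneg_right hc hM0
      _ = M * A * ‖T c‖ := by ring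
  calc ‖fderiv ℝ f x‖ ^ 2 ≤ (M * A * ‖T c‖) ^ 2 := pow_le_pow_left₀ (norm_nonneg _) h2 2
    _ = _ := by rw [mul_pow, hTc]

/-- The inverse inequality on a set `s` between the concentric balls with radii `r` and `R * r`. -/
lemma exists_inverse_inequality (d k : ℕ) (R : ℝ) :
    ∃ C : ℝ, 0 ≤ C ∧ ∀ f ∈ polys d k, ∀ (c : E d) (r : ℝ) (s : Set (E d)), 0 < r →
      IsCompact s → Metric.closedBall c r ⊆ s → s ⊆ Metric.closedBall c (R * r) →
      ∫ x in s, ‖fderiv ℝ f x‖ ^ 2 ≤ C * (r⁻¹) ^ 2 * ∫ x in s, f x ^ 2 := by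
  obtain ⟨C, hC0, hC⟩ := exists_fderiv_bound d k R
  set V : ℝ := volume.real (Metric.closedBall (0 : E d) R) with hV
  refine ⟨C * V, mul_nonneg hC0 measureReal_nonneg, fun f hf c r s hr hs hcs hsR => ?_⟩
  have hfc := continuous_of_mem_polys hf
  have hR : 0 ≤ R := by
    have h1 := hsR (hcs (Metric.mem_closedBall_self hr.le))
    rw [Metric.mem_closedBall, dist_self] at h1
    exact nonneg_of_mul_nonneg_left h1 hr
  -- Rescaling the inner ball to the unit ball. The factor r⁻¹ squared comes from the gradient; the
  -- r⁻ᵈ from the change of variables is later cancelled by the volume of s.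
  let g : E d → ℝ := fun y => f (c + r • y)
  have hg : g ∈ polys d k := polys_comp_homothety hf c r
  have hI : ∫ y in Metric.closedBall (0 : E d) 1, g y ^ 2
      = (r ^ d)⁻¹ * ∫ x in Metric.closedBall c r, f x ^ 2 := by
    have h1 := Measure.setIntegral_comp_smul_of_pos (μ := (volume : Measure (E d)))
      (fun y => f (c + y) ^ 2) (Metric.closedBall 0 1) hr
    rw [finrank_euclideanSpace_fin, smul_eq_mul, smul_unitClosedBall_of_nonneg hr.le] at h1
    rw [h1]
    congr 1
    have h2 := (measurePreserving_add_left (volume : Measure (E d)) c).setIntegral_preimage_emb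
      (measurableEmbedding_addLeft c) (fun x => f x ^ 2) (Metric.closedBall c r)
    rw [← h2]
    congr 2
    ext y
    simp [Metric.mem_closedBall, dist_eq_norm]
  have hIs : ∫ x in Metric.closedBall c r, f x ^ 2 ≤ ∫ x in s, f x ^ 2 :=
    setIntegral_mono_set ((hfc.pow 2).continuousOn.integrableOn_compact hs)
      (ae_of_all _ fun x => sq_nonneg _) (ae_of_all _ hcs)
  have hpt : ∀ x ∈ s, ‖fderiv ℝ f x‖ ^ 2
      ≤ C * (r⁻¹) ^ 2 * (r ^ d)⁻¹ * ∫ x in s, f x ^ 2 := by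
    intro x hx
    have hxc : x = c + r • (r⁻¹ • (x - c)) := by
      rw [smul_smul, mul_inv_cancel₀ hr.ne', one_smul]; abel
    set y := r⁻¹ • (x - c) with hy
    have hyR : ‖y‖ ≤ R := by
      have h1 := hsR hx
      rw [Metric.mem_closedBall, dist_eq_norm] at h1
      rw [hy, norm_smul, norm_inv, Real.norm_of_nonneg hr.le, inv_mul_le_iff₀ hr, mul_comm]
      exact h1
    have h1 := hC g hg y hyR
    have h2 : fderiv ℝ g y = r • fderiv ℝ f x := by
      have h3 : HasFDerivAt (fun y : E d => c + r • y) (r • ContinuousLinearMap.id ℝ (E d)) y :=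
        ((hasFDerivAt_id y).const_smul r).const_add c
      have h4 := ((contDiff_of_mem_polys (n := 1) hf).differentiable one_ne_zero
        (c + r • y)).hasFDerivAt.comp y h3
      have h5 : fderiv ℝ g y = _ := h4.fderiv
      rw [h5, ← hxc]
      ext z
      simp
    rw [h2, norm_smul, mul_pow, Real.norm_of_nonneg hr.le, hI] at h1
    have h3 : ‖fderiv ℝ f x‖ ^ 2 = (r⁻¹) ^ 2 * (r ^ 2 * ‖fderiv ℝ f x‖ ^ 2) := by
      field_simp
    rw [h3]
    calc (r⁻¹) ^ 2 * (r ^ 2 * ‖fderiv ℝ f x‖ ^ 2)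
        ≤ (r⁻¹) ^ 2 * (C * ((r ^ d)⁻¹ * ∫ x in s, f x ^ 2)) := by
          refine mul_le_mul_of_nonneg_left (h1.trans ?_) (by positivity)
          gcongr
      _ = _ := by ring
  have hvol : volume.real s ≤ r ^ d * V := by
    calc volume.real s ≤ volume.real (Metric.closedBall c (R * r)) :=
          measureReal_mono hsR measure_closedBall_lt_top.ne
      _ = r ^ d * V := by
          rw [hV, mul_comm R r, Measure.real, Measure.addHaar_closedBall_mul _ _ hr.le hR,
            ENNReal.toReal_mul, ENNReal.toReal_ofReal (by positivity), finrank_euclideanSpace_fin]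
          rfl
  have hint : IntegrableOn (fun x => ‖fderiv ℝ f x‖ ^ 2) s :=
    ((((contDiff_of_mem_polys (n := 1) hf).continuous_fderiv one_ne_zero).norm.pow
      2).continuousOn).integrableOn_compact hs
  have hs2 : 0 ≤ ∫ x in s, f x ^ 2 := integral_nonneg fun x => sq_nonneg _
  calc ∫ x in s, ‖fderiv ℝ f x‖ ^ 2
      ≤ ∫ _ in s, C * (r⁻¹) ^ 2 * (r ^ d)⁻¹ * ∫ x in s, f x ^ 2 :=
        setIntegral_mono_on hint (integrableOn_const hs.measure_lt_top.ne) hs.measurableSet hpt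
    _ = volume.real s * (C * (r⁻¹) ^ 2 * (r ^ d)⁻¹ * ∫ x in s, f x ^ 2) := by
        rw [setIntegral_const, smul_eq_mul]
    _ ≤ (r ^ d * V) * (C * (r⁻¹) ^ 2 * (r ^ d)⁻¹ * ∫ x in s, f x ^ 2) := by
        gcongr
    _ = C * V * (r⁻¹) ^ 2 * ∫ x in s, f x ^ 2 := by
        field_simp

end Polys

/-! ### The Poincaré inequality on convex sets -/

section Poincare

variable {d : ℕ}

lemma integrable_prod_of_continuous {X Y : Type*} [TopologicalSpace X] [TopologicalSpace Y]
    [MeasurableSpace X] [MeasurableSpace Y] [OpensMeasurableSpace X] [OpensMeasurableSpace Y]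
    [SecondCountableTopology X] [SecondCountableTopology Y] [T2Space X] [T2Space Y]
    {μ : Measure X} {ν : Measure Y} [SFinite μ] [SFinite ν]
    [IsFiniteMeasureOnCompacts μ] [IsFiniteMeasureOnCompacts ν]
    {s : Set X} {t : Set Y} (hs : IsCompact s) (ht : IsCompact t) {g : X × Y → ℝ}
    (hg : Continuous g) : Integrable g ((μ.restrict s).prod (ν.restrict t)) := by
  rw [Measure.prod_restrict]
  have hst := hs.prod ht
  have hm : MeasurableSet (s ×ˢ t) := hs.measurableSet.prod ht.measurableSet
  obtain ⟨C, hC⟩ := hst.exists_bound_of_continuousOn hg.continuousOn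
  refine IntegrableOn.of_bound ?_ hg.aestronglyMeasurable C
    ((ae_restrict_iff' hm).2 (ae_of_all _ hC))
  rw [Measure.prod_prod]
  exact ENNReal.mul_lt_top hs.measure_lt_top ht.measure_lt_top

/-- Cauchy–Schwarz, obtained by expanding the integral of the square of (b - a) f - I. -/
lemma sq_intervalIntegral_le {f : ℝ → ℝ} (hf : Continuous f) {a b : ℝ} (hab : a ≤ b) :
    (∫ t in a..b, f t) ^ 2 ≤ (b - a) * ∫ t in a..b, f t ^ 2 := by
  rcases hab.eq_or_lt with rfl | hlt
  · simp
  set I := ∫ t in a..b, f t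
  have hba : 0 < b - a := sub_pos.2 hlt
  have h1 : 0 ≤ ∫ t in a..b, ((b - a) * f t - I) ^ 2 :=
    intervalIntegral.integral_nonneg hab fun t _ => sq_nonneg _
  have h2 : ∫ t in a..b, ((b - a) * f t - I) ^ 2
      = (b - a) ^ 2 * (∫ t in a..b, f t ^ 2) - (b - a) * I ^ 2 := by
    have h3 : ∀ t, ((b - a) * f t - I) ^ 2
        = (b - a) ^ 2 * f t ^ 2 - 2 * (b - a) * I * f t + I ^ 2 := fun t => by ring
    simp_rw [h3]
    rw [intervalIntegral.integral_add, intervalIntegral.integral_sub,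
      intervalIntegral.integral_const_mul, intervalIntegral.integral_const_mul,
      intervalIntegral.integral_const, smul_eq_mul]
    · ring
    all_goals exact Continuous.intervalIntegrable (by fun_prop) _ _
  rw [h2] at h1
  have h4 : 0 ≤ (b - a) * ((b - a) * (∫ t in a..b, f t ^ 2) - I ^ 2) := by linarith
  have h5 := nonneg_of_mul_nonneg_right h4 hba
  linarith

/-- Contracting a convex set `s` towards `x ∈ s` by a factor `t ≥ 1/2`. -/
lemma setIntegral_comp_contraction_le {s : Set (E d)} (hs : IsCompact s) (hconv : Convex ℝ s)
    {g : E d → ℝ} (hg : Continuous g) (hg0 : ∀ x, 0 ≤ g x) {x : E d} (hx : x ∈ s) {t : ℝ}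
    (ht : 1 / 2 ≤ t) (ht1 : t ≤ 1) :
    ∫ y in s, g (x + t • (y - x)) ≤ 2 ^ d * ∫ y in s, g y := by
  have ht0 : 0 < t := by linarith
  have hJ : 0 ≤ ∫ y in s, g y := integral_nonneg hg0
  have h1 := Measure.setIntegral_comp_smul_of_pos (μ := (volume : Measure (E d)))
    (fun y => g ((1 - t) • x + y)) s ht0
  have h2 : ∀ y, x + t • (y - x) = (1 - t) • x + t • y := fun y => by module
  simp_rw [h2]
  rw [h1, finrank_euclideanSpace_fin, smul_eq_mul]
  have h3 := (measurePreserving_add_left (volume : Measure (E d))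
    ((1 - t) • x)).setIntegral_preimage_emb
    (measurableEmbedding_addLeft ((1 - t) • x)) g ((fun y => (1 - t) • x + t • y) '' s)
  have h4 : (fun y => (1 - t) • x + y) ⁻¹' ((fun y => (1 - t) • x + t • y) '' s)
      = (fun y => t • y) '' s := by
    ext z
    simp
  rw [h4, Set.image_smul] at h3
  rw [h3]
  have h5 : (fun y => (1 - t) • x + t • y) '' s ⊆ s := by
    rintro _ ⟨y, hy, rfl⟩
    exact hconv hx hy (by linarith) ht0.le (by ring)
  have h6 : ∫ y in (fun y => (1 - t) • x + t • y) '' s, g y ≤ ∫ y in s, g y :=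
    setIntegral_mono_set (hg.continuousOn.integrableOn_compact hs)
      (ae_of_all _ hg0) (ae_of_all _ h5)
  have h7 : (t ^ d)⁻¹ ≤ 2 ^ d := by
    rw [← inv_pow]
    refine pow_le_pow_left₀ (by positivity) ?_ d
    rw [inv_le_comm₀ ht0 (by norm_num)]
    linarith
  calc (t ^ d)⁻¹ * ∫ y in (fun y => (1 - t) • x + t • y) '' s, g y
      ≤ (t ^ d)⁻¹ * ∫ y in s, g y := mul_le_mul_of_nonneg_left h6 (by positivity)
    _ ≤ _ := mul_le_mul_of_nonneg_right h7 hJ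

/-- Restricting to t ≥ 1/2 keeps the contraction towards x from degenerating, so that integrating
over y costs at most 2 ^ d. The half in the constant is the length of the t-interval in
Cauchy–Schwarz. -/
lemma sq_sub_midpoint_le {f : E d → ℝ} (hf : ContDiff ℝ 1 f) {x y : E d} {h : ℝ}
    (hxy : dist x y ≤ h) :
    (f y - f (x + (1 / 2 : ℝ) • (y - x))) ^ 2
      ≤ h ^ 2 / 2 * ∫ t in (1 / 2 : ℝ)..1, ‖fderiv ℝ f (x + t • (y - x))‖ ^ 2 := by
  have hfd := hf.continuous_fderiv one_ne_zero
  have hline : Continuous fun t : ℝ => x + t • (y - x) := by fun_prop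
  have hc : Continuous fun t : ℝ => fderiv ℝ f (x + t • (y - x)) (y - x) :=
    (hfd.comp hline).clm_apply continuous_const
  have hFTC : ∫ t in (1 / 2 : ℝ)..1, fderiv ℝ f (x + t • (y - x)) (y - x)
      = f y - f (x + (1 / 2 : ℝ) • (y - x)) := by
    rw [intervalIntegral.integral_eq_sub_of_hasDerivAt (f := fun t : ℝ => f (x + t • (y - x)))]
    · simp
    · intro t _
      have h2 : HasDerivAt (fun t : ℝ => x + t • (y - x)) (y - x) t := by
        simpa using ((hasDerivAt_id t).smul_const (y - x)).const_add x
      exact ((hf.differentiable one_ne_zero).differentiableAt.hasFDerivAt).comp_hasDerivAt t h2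
    · exact hc.intervalIntegrable _ _
  rw [← hFTC]
  refine (sq_intervalIntegral_le hc (by norm_num)).trans ?_
  have h1 : ∫ t in (1 / 2 : ℝ)..1, (fderiv ℝ f (x + t • (y - x)) (y - x)) ^ 2
      ≤ ∫ t in (1 / 2 : ℝ)..1, h ^ 2 * ‖fderiv ℝ f (x + t • (y - x))‖ ^ 2 := by
    refine intervalIntegral.integral_mono_on (by norm_num) ((hc.pow 2).intervalIntegrable _ _)
      (Continuous.intervalIntegrable (by fun_prop) _ _) fun t _ => ?_
    have h2 := (fderiv ℝ f (x + t • (y - x))).le_opNorm (y - x)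
    have h3 : ‖y - x‖ ≤ h := by rwa [dist_comm, dist_eq_norm] at hxy
    rw [← sq_abs, ← mul_pow, ← Real.norm_eq_abs]
    refine pow_le_pow_left₀ (norm_nonneg _) (h2.trans ?_) 2
    rw [mul_comm]
    exact mul_le_mul_of_nonneg_right h3 (norm_nonneg _)
  rw [intervalIntegral.integral_const_mul] at h1
  linarith

/-- The Poincaré inequality on a compact convex set of diameter at most `h`. -/
theorem exists_poincare {s : Set (E d)} (hs : IsCompact s) (hconv : Convex ℝ s)
    (hvol : volume s ≠ 0) {h : ℝ} (hdiam : ∀ x ∈ s, ∀ y ∈ s, dist x y ≤ h)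
    {f : E d → ℝ} (hf : ContDiff ℝ 1 f) :
    ∃ c : ℝ, ∫ x in s, (f x - c) ^ 2 ≤ 2 ^ d * h ^ 2 * ∫ x in s, ‖fderiv ℝ f x‖ ^ 2 := by
  have hfd := hf.continuous_fderiv one_ne_zero
  have hfc := hf.continuous
  set G := ∫ x in s, ‖fderiv ℝ f x‖ ^ 2 with hG
  have hsm := hs.measurableSet
  have hsf : volume s ≠ ∞ := hs.measure_lt_top.ne
  have hg : Continuous fun x => ‖fderiv ℝ f x‖ ^ 2 := hfd.norm.pow 2
  -- the difference to the midpoint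
  have hmid : ∀ x ∈ s, ∫ y in s, (f y - f (x + (1 / 2 : ℝ) • (y - x))) ^ 2
      ≤ h ^ 2 / 4 * 2 ^ d * G := by
    intro x hx
    have hc2 : Continuous fun z : E d × ℝ => ‖fderiv ℝ f (x + z.2 • (z.1 - x))‖ ^ 2 := by fun_prop
    have hI : Integrable (fun z : E d × ℝ => ‖fderiv ℝ f (x + z.2 • (z.1 - x))‖ ^ 2)
        ((volume.restrict s).prod (volume.restrict (Set.Icc (1 / 2 : ℝ) 1))) :=
      integrable_prod_of_continuous hs isCompact_Icc hc2
    have hconvert : ∀ y, ∫ t in (1 / 2 : ℝ)..1, ‖fderiv ℝ f (x + t • (y - x))‖ ^ 2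
        = ∫ t in Set.Icc (1 / 2 : ℝ) 1, ‖fderiv ℝ f (x + t • (y - x))‖ ^ 2 := by
      intro y
      rw [intervalIntegral.integral_of_le (by norm_num), integral_Icc_eq_integral_Ioc]
    have h1 : ∫ y in s, (f y - f (x + (1 / 2 : ℝ) • (y - x))) ^ 2
        ≤ ∫ y in s, h ^ 2 / 2 *
          ∫ t in Set.Icc (1 / 2 : ℝ) 1, ‖fderiv ℝ f (x + t • (y - x))‖ ^ 2 := by
      refine setIntegral_mono_on ?_ ?_ hsm ?_
      · exact (Continuous.continuousOn (by fun_prop)).integrableOn_compact hs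
      · exact hI.integral_prod_left.const_mul _
      · intro y hy
        rw [← hconvert]
        exact sq_sub_midpoint_le hf (hdiam x hx y hy)
    refine h1.trans ?_
    rw [integral_const_mul, integral_integral_swap hI]
    have h2 : ∫ t in Set.Icc (1 / 2 : ℝ) 1, ∫ y in s, ‖fderiv ℝ f (x + t • (y - x))‖ ^ 2
        ≤ ∫ _ in Set.Icc (1 / 2 : ℝ) 1, 2 ^ d * G := by
      refine setIntegral_mono_on hI.integral_prod_right
        (integrableOn_const isCompact_Icc.measure_lt_top.ne) measurableSet_Icc fun t ht => ?_
      exact setIntegral_comp_contraction_le hs hconv hg (fun _ => sq_nonneg _) hx ht.1 ht.2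
    rw [setIntegral_const, smul_eq_mul, Real.volume_real_Icc_of_le (by norm_num)] at h2
    calc h ^ 2 / 2 * ∫ t in Set.Icc (1 / 2 : ℝ) 1, ∫ y in s, ‖fderiv ℝ f (x + t • (y - x))‖ ^ 2
        ≤ h ^ 2 / 2 * ((1 - 1 / 2) * (2 ^ d * G)) :=
          mul_le_mul_of_nonneg_left h2 (by positivity)
      _ = _ := by ring
  -- the double integral
  let φ : E d × E d → ℝ := fun z => (f z.2 - f z.1) ^ 2
  let ψ : E d × E d → ℝ := fun z => (f z.2 - f (z.1 + (1 / 2 : ℝ) • (z.2 - z.1))) ^ 2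
  have hφ : Integrable φ ((volume.restrict s).prod (volume.restrict s)) :=
    integrable_prod_of_continuous hs hs (by fun_prop)
  have hψ : Integrable ψ ((volume.restrict s).prod (volume.restrict s)) :=
    integrable_prod_of_continuous hs hs (by fun_prop)
  have hψI : ∫ z, ψ z ∂((volume.restrict s).prod (volume.restrict s))
      ≤ volume.real s * (h ^ 2 / 4 * 2 ^ d * G) := by
    rw [integral_prod _ hψ]
    have h1 := setIntegral_mono_on (s := s) (f := fun x => ∫ y in s, ψ (x, y))
      (g := fun _ => h ^ 2 / 4 * 2 ^ d * G) hψ.integral_prod_left (integrableOn_const hsf) hsm hmid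
    rwa [setIntegral_const, smul_eq_mul] at h1
  have hsym : ∫ z, ψ z.swap ∂((volume.restrict s).prod (volume.restrict s))
      = ∫ z, ψ z ∂((volume.restrict s).prod (volume.restrict s)) := integral_prod_swap ψ
  have hφI : ∫ z, φ z ∂((volume.restrict s).prod (volume.restrict s))
      ≤ volume.real s * (2 ^ d * h ^ 2 * G) := by
    -- The difference f y - f x is split at the midpoint of x and y. The two halves are exchanged by
    -- swapping the variables, so one bound covers both.
    calc ∫ z, φ z ∂((volume.restrict s).prod (volume.restrict s))
        ≤ ∫ z, (2 * ψ z + 2 * ψ z.swap) ∂((volume.restrict s).prod (volume.restrict s)) := by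
          refine integral_mono hφ ((hψ.const_mul 2).add (hψ.swap.const_mul 2)) fun z => ?_
          have h1 : z.2 + (1 / 2 : ℝ) • (z.1 - z.2) = z.1 + (1 / 2 : ℝ) • (z.2 - z.1) := by module
          simp only [φ, ψ, Prod.fst_swap, Prod.snd_swap, h1]
          nlinarith [sq_nonneg ((f z.2 - f (z.1 + (1 / 2 : ℝ) • (z.2 - z.1)))
            + (f z.1 - f (z.1 + (1 / 2 : ℝ) • (z.2 - z.1))))]
      _ = 4 * ∫ z, ψ z ∂((volume.restrict s).prod (volume.restrict s)) := by
          have := integral_add (hψ.const_mul 2) (hψ.swap.const_mul 2)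
          simp only [Function.comp_apply] at this
          rw [this, integral_const_mul, integral_const_mul, hsym]
          ring
      _ ≤ 4 * (volume.real s * (h ^ 2 / 4 * 2 ^ d * G)) := by gcongr
      _ = _ := by ring
  rw [integral_prod _ hφ] at hφI
  -- The constant is a value of f, at a point where the inner integral does not exceed its average;
  -- no mean value of f is needed.
  obtain ⟨c, -, hc⟩ := exists_le_setAverage hvol hsf hφ.integral_prod_left
  refine ⟨f c, hc.trans ?_⟩
  rw [setAverage_eq, smul_eq_mul]
  have hpos : 0 < volume.real s := ENNReal.toReal_pos hvol hsf
  rw [inv_mul_le_iff₀ hpos]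
  exact hφI

end Poincare

/-! ### The trace inequality -/

section Trace

open scoped Classical

variable {d : ℕ} {K : Finset (E d)} {lam : E d → E d →ᵃ[ℝ] ℝ}

lemma divergence_smul {g : E d → ℝ} {Y : E d → E d} {x : E d} (hg : DifferentiableAt ℝ g x)
    (hY : DifferentiableAt ℝ Y x) :
    divergence (fun x => g x • Y x) x = g x * divergence Y x + fderiv ℝ g x (Y x) := by
  unfold divergence
  rw [fderiv_fun_smul hg hY]
  simp only [add_apply, smul_apply, ContinuousLinearMap.smulRight_apply, PiLp.add_apply,
    PiLp.smul_apply, smul_eq_mul]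
  rw [Finset.sum_add_distrib, ← Finset.mul_sum]
  congr 1
  have h1 : Y x = ∑ i, Y x i • EuclideanSpace.single i (1 : ℝ) := by
    ext j
    simp [Pi.single_apply]
  conv_rhs => rw [h1]
  rw [map_sum]
  refine Finset.sum_congr rfl fun i _ => ?_
  rw [map_smul, smul_eq_mul, mul_comm]

lemma divergence_sub_const (a x : E d) : divergence (fun x => x - a) x = d := by
  unfold divergence
  rw [fderiv_sub_const, fderiv_fun_id]
  simp

namespace IsBary

lemma le_one_of_mem (h : IsBary K lam) {v x : E d} (hv : v ∈ K) (hx : x ∈ simplex K) :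
    lam v x ≤ 1 := by
  rw [← h.sum_one x]
  exact Finset.single_le_sum (f := fun v => lam v x) (h.mem_simplex_iff.1 hx) hv

/-- The points c ± r n lie in K, are 2r apart in the normal direction, and `lam v` stays in [0, 1]
on K. -/
lemma two_mul_le_height (h : IsBary K lam) (hcard : K.card = d + 1) (hd : 0 < d) {v : E d}
    (hv : v ∈ K) {c : E d} {r : ℝ} (hr : 0 < r) (hball : Metric.closedBall c r ⊆ simplex K) :
    2 * r ≤ height K v := by
  obtain ⟨h1, h2, h3⟩ := h.normal_height hcard hd hv
  set n := normal K (K.erase v)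
  have hp : c + r • n ∈ simplex K := hball (by simp [norm_smul, h1, abs_of_pos hr])
  have hm : c - r • n ∈ simplex K := hball (by simp [norm_smul, h1, abs_of_pos hr])
  have e1 := h3 (c + r • n)
  have e2 := h3 (c - r • n)
  rw [inner_add_right, inner_smul_right, real_inner_self_eq_norm_sq, h1] at e1
  rw [inner_sub_right, inner_smul_right, real_inner_self_eq_norm_sq, h1] at e2
  have l1 := h.mem_simplex_iff.1 hp v hv
  have l2 := h.le_one_of_mem hv hm
  nlinarith

/-- Projecting K onto the side parallel to the edge from v to a vertex a of the side preserves a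
diameter of the ball parallel to the side, since both its endpoints have the same `lam v`. Such a
direction exists because d ≥ 2 gives the side two vertices. -/
lemma two_mul_le_diam_side (h : IsBary K lam) (hcard : K.card = d + 1) (hd : 2 ≤ d) {v : E d}
    (hv : v ∈ K) {c : E d} {r : ℝ} (hr : 0 < r) (hball : Metric.closedBall c r ⊆ simplex K) :
    2 * r ≤ Metric.diam (simplex (K.erase v)) := by
  have hce : 1 < (K.erase v).card := by rw [Finset.card_erase_of_mem hv, hcard]; omega
  obtain ⟨a, ha, b, hb, hab⟩ := Finset.one_lt_card.1 hce
  obtain ⟨hav, haK⟩ := Finset.mem_erase.1 ha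
  obtain ⟨hbv, hbK⟩ := Finset.mem_erase.1 hb
  have hab0 : ‖a - b‖ ≠ 0 := norm_ne_zero_iff.2 (sub_ne_zero.2 hab)
  set u := ‖a - b‖⁻¹ • (a - b) with hu
  have hu1 : ‖u‖ = 1 := by rw [hu, norm_smul, norm_inv, norm_norm, inv_mul_cancel₀ hab0]
  have hlu : (lam v).linear u = 0 := by
    rw [hu, map_smul, h.linear_sub, h.other v hv a haK hav, h.other v hv b hbK hbv, sub_zero,
      smul_zero]
  have hψ : ∀ x ∈ simplex K, x + lam v x • (a - v) ∈ simplex (K.erase v) := by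
    intro x hx
    have hx' := h.mem_simplex_iff.1 hx
    rw [h.mem_side_iff hv, h.mem_simplex_iff]
    have hvv : lam v (x + lam v x • (a - v)) = 0 := by
      rw [add_smul, h.linear_sub, h.self v hv, h.other v hv a haK hav]; ring
    refine ⟨fun w hw => ?_, hvv⟩
    by_cases hwv : w = v
    · rw [hwv, hvv]
    · have hwa : 0 ≤ lam w a := by
        by_cases hwa : a = w
        · rw [hwa, h.self w hw]; norm_num
        · rw [h.other w hw a haK hwa]
      rw [add_smul, h.linear_sub, h.other w hw v hv (Ne.symm hwv), sub_zero]
      exact add_nonneg (hx' w hw) (mul_nonneg (hx' v hv) hwa)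
  have hp : c + r • u ∈ simplex K := hball (by simp [norm_smul, hu1, abs_of_pos hr])
  have hm : c + (-r) • u ∈ simplex K := hball (by simp [norm_smul, hu1, abs_of_pos hr])
  have hdist := Metric.dist_le_diam_of_mem (isCompact_simplex (K.erase v)).isBounded
    (hψ _ hp) (hψ _ hm)
  rw [add_smul, add_smul, hlu, mul_zero, mul_zero, add_zero, dist_eq_norm] at hdist
  have e1 : c + r • u + lam v c • (a - v) - (c + (-r) • u + lam v c • (a - v))
      = (2 * r) • u := by module
  rwa [e1, norm_smul, hu1, mul_one, Real.norm_of_nonneg (by positivity)] at hdist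

/-- The trace inequality, with the height of the simplex over the side. -/
lemma height_mul_sideInt_le (h : IsBary K lam) (hK : AffineIndependent ℝ ((↑) : K → E d))
    (hcard : K.card = d + 1) (hd : 0 < d) {v : E d} (hv : v ∈ K) {η : ℝ}
    (hη : ∀ x ∈ simplex K, dist x v ≤ η) {z : E d → ℝ} (hz : ContDiff ℝ 1 z) :
    height K v * sideInt (K.erase v) (fun x => z x ^ 2)
      ≤ ((d : ℝ) + 1) * (∫ x in simplex K, z x ^ 2)
        + η ^ 2 * ∫ x in simplex K, ‖fderiv ℝ z x‖ ^ 2 := by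
  have hKc := isCompact_simplex K
  have hzd := hz.continuous_fderiv one_ne_zero
  have hzc := hz.continuous
  -- The field x - v is tangential to every side through v, and its normal component on the opposite
  -- side is the height, so a single boundary term survives.
  have hdiv := integral_divergence hK hcard hd (X := fun x => (z x ^ 2) • (x - v)) (by fun_prop)
  rw [sum_sides hcard, Finset.sum_eq_single v] at hdiv
  rotate_left
  · intro u hu huv
    have hzero : ∀ x ∈ simplex (K.erase u),
        inner ℝ ((z x ^ 2) • (x - v)) (normal K (K.erase u)) = 0 := by
      intro x hx
      have hxu := ((h.mem_side_iff hu).1 hx).2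
      rw [inner_smul_left, real_inner_comm, h.inner_normal hcard hd hu, h.linear_sub, hxu,
        h.other u hu v hv huv.symm]
      simp
    rw [sideInt, setIntegral_congr_fun (isCompact_simplex _).measurableSet hzero, integral_zero]
  · exact fun h' => absurd hv h'
  have hval : sideInt (K.erase v)
      (fun x => inner ℝ ((z x ^ 2) • (x - v)) (normal K (K.erase v)))
      = height K v * sideInt (K.erase v) (fun x => z x ^ 2) := by
    unfold sideInt
    rw [← integral_const_mul]
    refine setIntegral_congr_fun (isCompact_simplex _).measurableSet fun x hx => ?_
    have hxv := ((h.mem_side_iff hv).1 hx).2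
    beta_reduce
    rw [inner_smul_left, real_inner_comm, h.inner_normal hcard hd hv, h.linear_sub, hxv,
      h.self v hv]
    simp [mul_comm]
  rw [← hval, ← hdiv, ← integral_const_mul, ← integral_const_mul, ← integral_add]
  rotate_left
  · exact (Continuous.continuousOn (by fun_prop)).integrableOn_compact hKc
  · exact (Continuous.continuousOn (by fun_prop)).integrableOn_compact hKc
  refine setIntegral_mono_on ?_ ?_ hKc.measurableSet fun x hx => ?_
  · exact (continuous_divergence (by fun_prop)).continuousOn.integrableOn_compact hKc
  · exact (Continuous.continuousOn (by fun_prop)).integrableOn_compact hKc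
  have hzx := hz.differentiable one_ne_zero x
  rw [divergence_smul (g := fun x => z x ^ 2) (hzx.pow 2) (by fun_prop), divergence_sub_const,
    fderiv_fun_pow 2 hzx]
  simp only [smul_apply, smul_eq_mul]
  have h1 : |fderiv ℝ z x (x - v)| ≤ ‖fderiv ℝ z x‖ * η := by
    refine ((fderiv ℝ z x).le_opNorm _).trans (mul_le_mul_of_nonneg_left ?_ (norm_nonneg _))
    rw [← dist_eq_norm]
    exact hη x hx
  have h2 : (fderiv ℝ z x (x - v)) ^ 2 ≤ η ^ 2 * ‖fderiv ℝ z x‖ ^ 2 := by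
    rw [← sq_abs, ← mul_pow, mul_comm η]
    exact pow_le_pow_left₀ (abs_nonneg _) h1 2
  simp only [Nat.reduceSub, pow_one, nsmul_eq_mul, Nat.cast_ofNat]
  -- Young's inequality on the cross term 2 z ∂z raises the coefficient of z² from d to d + 1.
  nlinarith [sq_nonneg (z x - fderiv ℝ z x (x - v))]

end IsBary

end Trace

/-! ### Approximation on sides by the elementwise projection -/

section Element

open scoped Classical

variable {d : ℕ}

/-- On a shape regular simplex, the traces of a function minus its `L²` projection onto polynomials
are bounded by the gradient of the function. -/
theorem exists_projection_trace (d k : ℕ) (hd : 2 ≤ d) (σ : ℝ) :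
    ∃ C : ℝ, 0 ≤ C ∧ ∀ K : Finset (E d), AffineIndependent ℝ ((↑) : K → E d) → K.card = d + 1 →
      ∀ (c : E d) (r : ℝ), 0 < r → Metric.ball c r ⊆ simplex K →
      Metric.diam (simplex K) ≤ σ * (2 * r) →
      ∀ f : E d → ℝ, ContDiff ℝ 1 f → ∃ p ∈ polys d k,
        (∀ s ∈ polys d k, ∫ x in simplex K, (f x - p x) * s x = 0) ∧
        ∀ e ∈ sides K, sideInt e (fun x => (f x - p x) ^ 2)
          ≤ C * Metric.diam (simplex e) * ∫ x in simplex K, ‖fderiv ℝ f x‖ ^ 2 := by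
  obtain ⟨Ci, hCi0, hCi⟩ := exists_inverse_inequality d k (2 * σ)
  -- The three summands come from the `L²` norm of f - p by Poincaré, from ∇f, and from ∇p by the
  -- inverse and Poincaré inequalities.
  set B : ℝ := ((d : ℝ) + 1) * 2 ^ d + 2 + 8 * σ ^ 2 * Ci * 2 ^ d with hB
  have hB0 : 0 ≤ B := by positivity
  refine ⟨σ ^ 2 * B, by positivity, fun K hK hcard c r hr hball hdiam f hf => ?_⟩
  obtain ⟨lam, h⟩ := exists_isBary hK hcard
  have hKc := isCompact_simplex K
  have hcb : Metric.closedBall c r ⊆ simplex K := by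
    rw [← closure_ball c hr.ne']
    exact closure_minimal hball hKc.isClosed
  obtain ⟨p, hp, hpo⟩ := exists_projection k hKc hf.continuous
  refine ⟨p, hp, hpo, fun e he => ?_⟩
  rw [sides_eq_image hcard, Finset.mem_image] at he
  obtain ⟨v, hv, rfl⟩ := he
  set η := Metric.diam (simplex K) with hη
  have hη0 : 0 ≤ η := Metric.diam_nonneg
  have hdist : ∀ x ∈ simplex K, ∀ y ∈ simplex K, dist x y ≤ η := fun x hx y hy =>
    Metric.dist_le_diam_of_mem hKc.isBounded hx hy
  have hvol : volume (simplex K) ≠ 0 := by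
    refine (lt_of_lt_of_le ?_ (measure_mono hball)).ne'
    exact Metric.measure_ball_pos _ _ hr
  obtain ⟨m, hm⟩ := exists_poincare hKc (convex_convexHull ℝ _) hvol hdist hf
  set G := ∫ x in simplex K, ‖fderiv ℝ f x‖ ^ 2 with hG
  have hG0 : 0 ≤ G := integral_nonneg fun x => sq_nonneg _
  have hpc := continuous_of_mem_polys hp
  have hpd : ContDiff ℝ 1 p := contDiff_of_mem_polys hp
  have hfc := hf.continuous
  have hfd := hf.continuous_fderiv one_ne_zero
  have hpfd := hpd.continuous_fderiv one_ne_zero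
  have hio : ∀ {g : E d → ℝ}, Continuous g → IntegrableOn g (simplex K) := fun hg =>
    hg.continuousOn.integrableOn_compact hKc
  -- the projection is a best approximation
  have hpm : (fun x => p x - m) ∈ polys d k :=
    mem_polySpace.1 (Submodule.sub_mem _ (mem_polySpace.2 hp) (mem_polySpace.2 (const_mem_polys m)))
  have hpyth : ∫ x in simplex K, (f x - m) ^ 2
      = (∫ x in simplex K, (f x - p x) ^ 2) + ∫ x in simplex K, (p x - m) ^ 2 := by
    have h1 : ∀ x, (f x - m) ^ 2
        = ((f x - p x) ^ 2 + (p x - m) ^ 2) + 2 * ((f x - p x) * (p x - m)) := fun x => by ring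
    simp_rw [h1]
    rw [integral_add (hio (by fun_prop)) (hio (by fun_prop)),
      integral_add (hio (by fun_prop)) (hio (by fun_prop)), integral_const_mul, hpo _ hpm]
    ring
  have hz0 : 0 ≤ ∫ x in simplex K, (f x - p x) ^ 2 := integral_nonneg fun x => sq_nonneg _
  have hp0 : 0 ≤ ∫ x in simplex K, (p x - m) ^ 2 := integral_nonneg fun x => sq_nonneg _
  have hN : ∫ x in simplex K, (f x - m) ^ 2 ≤ 2 ^ d * η ^ 2 * G := hm
  -- the gradient of the projection
  have hKR : simplex K ⊆ Metric.closedBall c (2 * σ * r) := by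
    intro x hx
    rw [Metric.mem_closedBall]
    refine (hdist x hx c (hcb (Metric.mem_closedBall_self hr.le))).trans (hdiam.trans_eq ?_)
    ring
  -- Subtracting the Poincaré constant m leaves the gradient of p unchanged, while p - m is
  -- controlled by f - m.
  have hinv := hCi _ hpm c r (simplex K) hr hKc hcb hKR
  simp_rw [fderiv_sub_const] at hinv
  have hgz : ∫ x in simplex K, ‖fderiv ℝ (fun x => f x - p x) x‖ ^ 2
      ≤ 2 * G + 2 * ∫ x in simplex K, ‖fderiv ℝ p x‖ ^ 2 := by
    rw [hG, ← integral_const_mul, ← integral_const_mul,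
      ← integral_add (hio (by fun_prop)) (hio (by fun_prop))]
    refine setIntegral_mono_on (hio ?_) (hio (by fun_prop)) hKc.measurableSet fun x _ => ?_
    · exact ((hf.sub hpd).continuous_fderiv one_ne_zero).norm.pow 2
    · rw [fderiv_fun_sub (hf.differentiable one_ne_zero x) (hpd.differentiable one_ne_zero x)]
      have h1 := norm_sub_le (fderiv ℝ f x) (fderiv ℝ p x)
      have h2 := pow_le_pow_left₀ (norm_nonneg _) h1 2
      nlinarith [sq_nonneg (‖fderiv ℝ f x‖ - ‖fderiv ℝ p x‖)]
  have htr := h.height_mul_sideInt_le hK hcard (by omega) hv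
    (fun x hx => hdist x hx v (subset_convexHull ℝ _ hv)) (hf.sub hpd)
  have hH := h.two_mul_le_height hcard (by omega) hv hr hcb
  have hside := h.two_mul_le_diam_side hcard hd hv hr hcb
  set S := sideInt (K.erase v) (fun x => (f x - p x) ^ 2) with hS
  have hS0 : 0 ≤ S := integral_nonneg fun x => sq_nonneg _
  have hησ : η ^ 2 ≤ 4 * σ ^ 2 * r ^ 2 := by
    calc η ^ 2 ≤ (σ * (2 * r)) ^ 2 := pow_le_pow_left₀ hη0 hdiam 2
      _ = _ := by ring
  have hηr : η ^ 2 * (r⁻¹) ^ 2 ≤ 4 * σ ^ 2 := by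
    rw [inv_pow, mul_inv_le_iff₀ (by positivity)]
    exact hησ
  set N := ∫ x in simplex K, (f x - m) ^ 2 with hNdef
  have hN0 : 0 ≤ N := integral_nonneg fun x => sq_nonneg _
  have hgp : η ^ 2 * ∫ x in simplex K, ‖fderiv ℝ p x‖ ^ 2 ≤ 4 * σ ^ 2 * Ci * N := by
    calc η ^ 2 * ∫ x in simplex K, ‖fderiv ℝ p x‖ ^ 2
        ≤ η ^ 2 * (Ci * (r⁻¹) ^ 2 * N) := by
          refine mul_le_mul_of_nonneg_left (hinv.trans ?_) (by positivity)
          refine mul_le_mul_of_nonneg_left ?_ (by positivity)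
          linarith
      _ = (η ^ 2 * (r⁻¹) ^ 2) * (Ci * N) := by ring
      _ ≤ 4 * σ ^ 2 * (Ci * N) := mul_le_mul_of_nonneg_right hηr (by positivity)
      _ = _ := by ring
  have hmain : 2 * r * S ≤ η ^ 2 * B * G := by
    calc 2 * r * S ≤ height K v * S := mul_le_mul_of_nonneg_right hH hS0
      _ ≤ ((d : ℝ) + 1) * (∫ x in simplex K, (f x - p x) ^ 2)
          + η ^ 2 * ∫ x in simplex K, ‖fderiv ℝ (fun x => f x - p x) x‖ ^ 2 := htr
      _ ≤ ((d : ℝ) + 1) * N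
          + η ^ 2 * (2 * G + 2 * ∫ x in simplex K, ‖fderiv ℝ p x‖ ^ 2) := by
          gcongr
          linarith
      _ = ((d : ℝ) + 1) * N + 2 * η ^ 2 * G
          + 2 * (η ^ 2 * ∫ x in simplex K, ‖fderiv ℝ p x‖ ^ 2) := by ring
      _ ≤ ((d : ℝ) + 1) * N + 2 * η ^ 2 * G + 2 * (4 * σ ^ 2 * Ci * N) := by gcongr
      _ = (((d : ℝ) + 1) + 8 * σ ^ 2 * Ci) * N + 2 * η ^ 2 * G := by ring
      _ ≤ (((d : ℝ) + 1) + 8 * σ ^ 2 * Ci) * (2 ^ d * η ^ 2 * G) + 2 * η ^ 2 * G := by gcongr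
      _ = η ^ 2 * B * G := by rw [hB]; ring
  -- Shape regularity turns η² into r². One factor r cancels against the height, and the other is
  -- bounded by the diameter of the side.
  have h2 : r * (2 * S) ≤ r * (σ ^ 2 * B * (2 * (2 * r)) * G) := by
    calc r * (2 * S) = 2 * r * S := by ring
      _ ≤ η ^ 2 * B * G := hmain
      _ ≤ (4 * σ ^ 2 * r ^ 2) * B * G := by gcongr
      _ = _ := by ring
  have h3 := le_of_mul_le_mul_left h2 hr
  calc S ≤ σ ^ 2 * B * (2 * r) * G := by linarith
    _ ≤ σ ^ 2 * B * Metric.diam (simplex (K.erase v)) * G := by gcongr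

end Element

/-! ### Meshes as partitions of the domain -/

namespace Mesh

open scoped Classical

variable {d : ℕ} (T : Mesh d)

lemma mem_elements {K : Finset (E d)} : K ∈ T.elements ↔ K ∈ T.faces ∧ K.card = d + 1 := by
  simp [elements]

variable {T} in
lemma indep_of_mem_elements {K : Finset (E d)} (hK : K ∈ T.elements) :
    AffineIndependent ℝ ((↑) : K → E d) := T.indep (T.mem_elements.1 hK).1

variable {T} in
lemma card_of_mem_elements {K : Finset (E d)} (hK : K ∈ T.elements) : K.card = d + 1 :=
  (T.mem_elements.1 hK).2

variable {T} in
lemma integrableOn_side {K e : Finset (E d)} (hK : K ∈ T.elements) (he : e ∈ sides K) (hd : 0 < d)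
    {f : E d → ℝ} (hf : ContinuousOn f (simplex e)) :
    IntegrableOn f (simplex e) (Measure.euclideanHausdorffMeasure (d - 1)) := by
  have hcard := card_of_mem_elements hK
  obtain ⟨lam, h⟩ := exists_isBary (indep_of_mem_elements hK) hcard
  rw [sides_eq_image hcard, Finset.mem_image] at he
  obtain ⟨v, hv, rfl⟩ := he
  exact h.integrableOn_side hcard hd hv hf

lemma ae_eq_interior {K : Finset (E d)} :
    (simplex K : Set (E d)) =ᵐ[volume] interior (simplex K) :=
  (interior_ae_eq_of_null_frontier (Convex.addHaar_frontier volume (convex_convexHull ℝ _))).symm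

variable {T} in
lemma interior_subset_domain {K : Finset (E d)} (hK : K ∈ T.elements) :
    interior (simplex K) ⊆ T.domain :=
  interior_mono (T.toSimplicialComplex.convexHull_subset_space (T.mem_elements.1 hK).1)

variable {T} in
lemma restrict_simplex_le {K : Finset (E d)} (hK : K ∈ T.elements) :
    (volume : Measure (E d)).restrict (simplex K) ≤ volume.restrict T.domain := by
  rw [Measure.restrict_congr_set ae_eq_interior]
  exact Measure.restrict_mono (interior_subset_domain hK) le_rfl

lemma volume_side_eq_zero {K : Finset (E d)} (hK : AffineIndependent ℝ ((↑) : K → E d))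
    {v : E d} (hv : v ∈ K) : volume (simplex (K.erase v)) = 0 := by
  have h1 := hK.notMem_affineSpan_sdiff ⟨v, hv⟩ Set.univ
  have h2 : ((↑) : K → E d) '' (Set.univ \ {⟨v, hv⟩}) = (K.erase v : Finset (E d)) := by
    ext x
    simp only [Set.mem_image, Set.mem_sdiff, Set.mem_univ, Set.mem_singleton_iff, true_and,
      Subtype.exists, Finset.mem_coe, Finset.mem_erase, Subtype.mk.injEq, exists_and_right,
      exists_eq_right]
    tauto
  rw [h2] at h1
  refine measure_mono_null (convexHull_subset_affineSpan _)
    (Measure.addHaar_affineSubspace volume _ fun h3 => h1 ?_)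
  rw [h3]
  exact AffineSubspace.mem_top ℝ _ _

variable {T} in
-- The closed simplices meet in the hull of their common vertices, which lies in a side of K and so
-- is null; an open null set is empty.
lemma disjoint_interior {K L : Finset (E d)} (hK : K ∈ T.elements) (hL : L ∈ T.elements)
    (hKL : K ≠ L) : Disjoint (interior (simplex K)) (interior (simplex L)) := by
  rw [Set.disjoint_iff_inter_eq_empty]
  refine ((isOpen_interior.inter isOpen_interior).measure_eq_zero_iff
    (volume : Measure (E d))).1 ?_
  have hnot : ¬ K ⊆ L := fun h => hKL (Finset.eq_of_subset_of_card_le h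
    (by rw [card_of_mem_elements hK, card_of_mem_elements hL]))
  obtain ⟨v, hv, hvL⟩ := Finset.not_subset.1 hnot
  refine measure_mono_null ?_ (volume_side_eq_zero (indep_of_mem_elements hK) hv)
  refine (Set.inter_subset_inter interior_subset interior_subset).trans
    ((T.inter_subset_convexHull (T.mem_elements.1 hK).1 (T.mem_elements.1 hL).1).trans
      (convexHull_mono ?_))
  rintro x ⟨hxK, hxL⟩
  refine Finset.mem_coe.2 (Finset.mem_erase.2 ⟨?_, hxK⟩)
  rintro rfl
  exact hvL hxL

lemma isCompact_space : IsCompact T.space := by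
  unfold Geometry.SimplicialComplex.space
  exact T.finite.isCompact_biUnion fun s _ => isCompact_simplex s

/-- The element interiors are disjoint subsets of the domain. For a nonnegative integrand this
direction suffices, so no covering argument is needed. -/
lemma sum_setIntegral_le {f : E d → ℝ} (hf : Continuous f) (hf0 : ∀ x, 0 ≤ f x) :
    ∑ K ∈ T.elements, ∫ x in simplex K, f x ≤ ∫ x in T.domain, f x := by
  have hint : IntegrableOn f T.domain :=
    (hf.continuousOn.integrableOn_compact T.isCompact_space).mono_set interior_subset
  calc ∑ K ∈ T.elements, ∫ x in simplex K, f x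
      = ∑ K ∈ T.elements, ∫ x in interior (simplex K), f x :=
        Finset.sum_congr rfl fun K _ => setIntegral_congr_set ae_eq_interior
    _ = ∫ x in ⋃ K ∈ T.elements, interior (simplex K), f x := by
        rw [integral_biUnion_finset]
        · exact fun K _ => isOpen_interior.measurableSet
        · exact fun K hK L hL hKL => disjoint_interior hK hL hKL
        · exact fun K hK => hint.mono_set (interior_subset_domain hK)
    _ ≤ ∫ x in T.domain, f x := by
        refine setIntegral_mono_set hint (ae_of_all _ hf0) (ae_of_all _ ?_)
        exact Set.iUnion₂_subset fun K hK => interior_subset_domain hK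

end Mesh

namespace Mesh

open scoped Classical

variable {d : ℕ} {T : Mesh d} {k : ℕ} {τ : Finset (E d) → Finset (E d) → ℝ}
  {q : Finset (E d) → E d → E d} {u uhat : Finset (E d) → E d → ℝ}

/-! ### The numerical flux -/

lemma mem_skeleton {K e : Finset (E d)} (hK : K ∈ T.elements) (he : e ∈ sides K) :
    e ∈ T.skeleton := Finset.mem_biUnion.2 ⟨K, hK, he⟩

/-- The normal and τ are constant on a side, so the flux has the degree allowed in `Mh` and can
serve as a test function. -/
lemma exists_flux_eq_poly (hq : q ∈ T.Vh k) (hu : u ∈ T.Wh k) (huhat : uhat ∈ T.Mh k)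
    {K e : Finset (E d)} (hK : K ∈ T.elements) (he : e ∈ sides K) :
    ∃ p ∈ polys d k, Set.EqOn (flux τ q u uhat K e) p (simplex e) := by
  obtain ⟨m, hm, hme⟩ := huhat e (mem_skeleton hK he)
  refine ⟨(∑ i, normal K e i • (fun x => q K x i)) + τ K e • (u K - m), ?_, fun x hx => ?_⟩
  · rw [← mem_polySpace]
    refine Submodule.add_mem _ (Submodule.sum_mem _ fun i _ => ?_) ?_
    · exact Submodule.smul_mem _ _ (mem_polySpace.2 (hq K hK i))
    · exact Submodule.smul_mem _ _
        (Submodule.sub_mem _ (mem_polySpace.2 (hu K hK)) (mem_polySpace.2 hm))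
  · simp [flux, hme hx, PiLp.inner_apply]

lemma continuousOn_uhat (huhat : uhat ∈ T.Mh k) {K e : Finset (E d)} (hK : K ∈ T.elements)
    (he : e ∈ sides K) : ContinuousOn (uhat e) (simplex e) := by
  obtain ⟨m, hm, hme⟩ := huhat e (mem_skeleton hK he)
  exact (continuous_of_mem_polys hm).continuousOn.congr hme

lemma continuousOn_flux (hq : q ∈ T.Vh k) (hu : u ∈ T.Wh k) (huhat : uhat ∈ T.Mh k)
    {K e : Finset (E d)} (hK : K ∈ T.elements) (he : e ∈ sides K) :
    ContinuousOn (flux τ q u uhat K e) (simplex e) := by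
  obtain ⟨p, hp, hpe⟩ := exists_flux_eq_poly (τ := τ) hq hu huhat hK he
  exact (continuous_of_mem_polys hp).continuousOn.congr hpe

/-- Summation over the interior sides instead of the elements. -/
lemma innerInt_eq (f : Finset (E d) → Finset (E d) → E d → ℝ) :
    T.innerInt f = ∑ e ∈ T.skeleton with ¬ T.OnBdry e,
      ∑ K ∈ T.elements with e ∈ sides K, sideInt e (f K e) := by
  unfold innerInt
  refine Finset.sum_comm' fun K e => ?_
  simp only [Finset.mem_filter]
  constructor
  · rintro ⟨hK, he, hb⟩
    exact ⟨⟨hK, he⟩, mem_skeleton hK he, hb⟩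
  · rintro ⟨⟨hK, he⟩, -, hb⟩
    exact ⟨hK, he, hb⟩

/-- The flux is continuous across interior sides, so that it is orthogonal to all continuous
functions. -/
lemma innerInt_mul_flux (hd : 0 < d) (hq : q ∈ T.Vh k) (hu : u ∈ T.Wh k) (huhat : uhat ∈ T.Mh k)
    (hflux : T.FluxEq k τ q u uhat) {f : E d → ℝ} (hf : Continuous f) :
    T.innerInt (fun K e x => f x * flux τ q u uhat K e x) = 0 := by
  rw [innerInt_eq]
  refine Finset.sum_eq_zero fun e he => ?_
  obtain ⟨hes, heb⟩ := Finset.mem_filter.1 he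
  set S := T.elements.filter fun K => e ∈ sides K with hS
  have hpoly : ∀ K ∈ S, ∃ p ∈ polys d k, Set.EqOn (flux τ q u uhat K e) p (simplex e) := by
    intro K hK
    obtain ⟨hK1, hK2⟩ := Finset.mem_filter.1 hK
    exact exists_flux_eq_poly hq hu huhat hK1 hK2
  choose! p hp hpe using hpoly
  -- P is the flux jump across e: the sum over all elements having e as a side, whatever their
  -- number. Testing with P on e and zero elsewhere gives its square integral.
  set P : E d → ℝ := ∑ K ∈ S, p K with hP
  have hPk : P ∈ polys d k := by
    rw [← mem_polySpace]
    exact Submodule.sum_mem _ fun K hK => mem_polySpace.2 (hp K hK)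
  have hPc := continuous_of_mem_polys hPk
  obtain ⟨K₀, hK₀, heK₀⟩ := Finset.mem_biUnion.1 hes
  have hem : MeasurableSet (simplex e) := (isCompact_simplex e).measurableSet
  have hsum : ∀ g : E d → ℝ, Continuous g →
      ∑ K ∈ S, sideInt e (fun x => g x * flux τ q u uhat K e x)
        = sideInt e (fun x => g x * P x) := by
    intro g hg
    unfold sideInt
    rw [← integral_finsetSum]
    · refine setIntegral_congr_fun hem fun x hx => ?_
      rw [hP, Finset.sum_apply, Finset.mul_sum]
      exact Finset.sum_congr rfl fun K hK => by rw [hpe K hK hx]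
    · intro K hK
      exact integrableOn_side hK₀ heK₀ hd (hg.continuousOn.mul
        ((continuous_of_mem_polys (hp K hK)).continuousOn.congr (hpe K hK)))
  have htest : sideInt e (fun x => P x * P x) = 0 := by
    have h1 := hflux (fun e' => if e' = e then P else fun _ => 0) (by
      intro e' _
      by_cases h : e' = e
      · exact ⟨P, hPk, by simp [h, Set.EqOn]⟩
      · exact ⟨fun _ => 0, zero_mem_polys, by simp [h, Set.EqOn]⟩)
    rw [innerInt_eq, Finset.sum_eq_single e] at h1
    · rw [← hsum P hPc, ← h1]
      refine Finset.sum_congr rfl fun K _ => ?_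
      simp [mul_comm]
    · intro e' _ he'
      refine Finset.sum_eq_zero fun K _ => ?_
      simp [he', sideInt]
    · exact fun h => absurd he h
  have hae : (fun x => P x * P x)
      =ᵐ[(Measure.euclideanHausdorffMeasure (d - 1)).restrict (simplex e)] 0 :=
    (integral_eq_zero_iff_of_nonneg (fun x => mul_self_nonneg _)
      (integrableOn_side hK₀ heK₀ hd (hPc.mul hPc).continuousOn)).1 htest
  rw [hsum f hf]
  refine integral_eq_zero_of_ae ?_
  filter_upwards [hae] with x hx
  have : P x = 0 := mul_self_eq_zero.1 hx
  simp [this]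

lemma bdryInt_eq (f : Finset (E d) → Finset (E d) → E d → ℝ) :
    T.bdryInt f = T.gammaInt f + T.innerInt f := by
  unfold bdryInt gammaInt innerInt
  rw [← Finset.sum_add_distrib]
  exact Finset.sum_congr rfl fun K _ => (Finset.sum_filter_add_sum_filter_not _ _ _).symm

/-- Integration by parts for the boundary term. The function `p` stands for an element-wise
`L²` projection of `f` onto polynomials. -/
lemma gammaInt_mul_flux (hd : 0 < d) (hq : q ∈ T.Vh k) (hu : u ∈ T.Wh k) (huhat : uhat ∈ T.Mh k)
    (hdiv : T.DivEq k τ q u uhat) (hflux : T.FluxEq k τ q u uhat) {f : E d → ℝ}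
    (hf : ContDiff ℝ 1 f) {p : Finset (E d) → E d → ℝ} (hp : p ∈ T.Wh k)
    (hpo : ∀ K ∈ T.elements, ∀ s ∈ polys d k, ∫ x in simplex K, (f x - p K x) * s x = 0) :
    T.gammaInt (fun K e x => f x * flux τ q u uhat K e x)
      = T.volInt (fun K x => fderiv ℝ f x (q K x))
        + T.bdryInt (fun K e x => τ K e * (u K x - uhat e x) * (f x - p K x)) := by
  have hfc := hf.continuous
  have h1 := T.bdryInt_eq (fun K e x => f x * flux τ q u uhat K e x)
  rw [innerInt_mul_flux hd hq hu huhat hflux hfc, add_zero] at h1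
  -- The projection is the test function of the divergence equation; its boundary part is what
  -- replaces f by f - p in the τ-term.
  have h2 := hdiv p hp
  rw [← h1, ← sub_zero (T.bdryInt _), ← h2]
  unfold bdryInt volInt
  rw [← Finset.sum_add_distrib, ← Finset.sum_add_distrib, ← Finset.sum_sub_distrib]
  refine Finset.sum_congr rfl fun K hK => ?_
  have hcard := card_of_mem_elements hK
  have hKc := isCompact_simplex K
  have hqc : ContDiff ℝ 1 (q K) := contDiff_of_mem_vecPolys (hq K hK)
  have huc := continuous_of_mem_polys (hu K hK)
  have hpc := continuous_of_mem_polys (hp K hK)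
  have hdq := divergence_mem_polys (hq K hK)
  have hdqc := continuous_of_mem_polys hdq
  have hio : ∀ {g : E d → ℝ}, Continuous g → IntegrableOn g (simplex K) := fun hg =>
    hg.continuousOn.integrableOn_compact hKc
  have hfdq : Continuous fun x => fderiv ℝ f x (q K x) :=
    (hf.continuous_fderiv one_ne_zero).clm_apply hqc.continuous
  have hgreen := integral_divergence (indep_of_mem_elements hK) hcard hd
    (X := fun x => f x • q K x) (hf.smul hqc)
  have hdivf : ∀ x, divergence (fun x => f x • q K x) x
      = f x * divergence (q K) x + fderiv ℝ f x (q K x) := fun x =>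
    divergence_smul (hf.differentiable one_ne_zero x) (hqc.differentiable one_ne_zero x)
  have e1 : ∫ x in simplex K, divergence (fun x => f x • q K x) x
      = (∫ x in simplex K, divergence (q K) x * p K x)
        + ∫ x in simplex K, fderiv ℝ f x (q K x) := by
    simp_rw [hdivf]
    rw [integral_add (hio (by fun_prop)) (hio hfdq)]
    congr 1
    -- Orthogonality to div q replaces f by p in the volume term.
    have h3 := hpo K hK _ hdq
    have h4 : ∀ x, (f x - p K x) * divergence (q K) x
        = f x * divergence (q K) x - divergence (q K) x * p K x := fun x => by ring
    simp_rw [h4] at h3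
    rw [integral_sub (hio (by fun_prop)) (hio (by fun_prop))] at h3
    linarith
  have e2 : ∀ e ∈ sides K, sideInt e (fun x => f x * flux τ q u uhat K e x)
      = sideInt e (fun x => inner ℝ (f x • q K x) (normal K e))
        + (sideInt e (fun x => τ K e * (u K x - uhat e x) * (f x - p K x))
          + sideInt e (fun x => τ K e * (u K x - uhat e x) * p K x)) := by
    intro e he
    have huh := continuousOn_uhat huhat hK he
    unfold sideInt
    rw [← integral_add, ← integral_add]
    · refine setIntegral_congr_fun (isCompact_simplex e).measurableSet fun x _ => ?_
      simp only [flux, inner_smul_left, conj_trivial]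
      ring
    · refine integrableOn_side hK he hd (Continuous.continuousOn ?_)
      have := hqc.continuous
      fun_prop
    · refine (integrableOn_side hK he hd ?_).add (integrableOn_side hK he hd ?_) <;> fun_prop
    · refine integrableOn_side hK he hd ?_; fun_prop
    · refine integrableOn_side hK he hd ?_; fun_prop
  rw [Finset.sum_congr rfl e2, Finset.sum_add_distrib, Finset.sum_add_distrib, ← hgreen]
  rw [e1]
  ring

lemma tau_mul_diam_le {D : ℝ} (hD : (T.hTauNorm τ : ℝ) ≤ D) {K e : Finset (E d)}
    (hK : K ∈ T.elements) (he : e ∈ sides K) : Metric.diam (simplex e) * τ K e ≤ D := by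
  have h1 : ‖Metric.diam (simplex e) * τ K e‖₊ ≤ T.hTauNorm τ :=
    (Finset.le_sup (f := fun e => ‖Metric.diam (simplex e) * τ K e‖₊) he).trans
      (Finset.le_sup (f := fun K => (sides K).sup fun e => ‖Metric.diam (simplex e) * τ K e‖₊) hK)
  exact (Real.le_norm_self _).trans ((NNReal.coe_le_coe.2 h1).trans hD)

lemma tauForm_nonneg (hτ : ∀ K ∈ T.elements, ∀ e ∈ sides K, 0 ≤ τ K e) :
    0 ≤ T.tauForm τ u uhat := by
  refine Finset.sum_nonneg fun K hK => Finset.sum_nonneg fun e he => integral_nonneg fun x => ?_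
  have := hτ K hK e he
  have h2 := mul_self_nonneg (u K x - uhat e x)
  have := mul_nonneg this h2
  simpa [mul_assoc] using this

/-- The estimate of the boundary term for a smooth function. -/
lemma gammaInt_mul_flux_le (hd : 0 < d) (hq : q ∈ T.Vh k) (hu : u ∈ T.Wh k)
    (huhat : uhat ∈ T.Mh k) (hdiv : T.DivEq k τ q u uhat) (hflux : T.FluxEq k τ q u uhat)
    (hτ : ∀ K ∈ T.elements, ∀ e ∈ sides K, 0 ≤ τ K e) {D : ℝ}
    (hD : (T.hTauNorm τ : ℝ) ≤ D) {C : ℝ} (hC : 0 ≤ C) {f : E d → ℝ} (hf : ContDiff ℝ 1 f)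
    (hproj : ∀ K ∈ T.elements, ∃ p ∈ polys d k,
      (∀ s ∈ polys d k, ∫ x in simplex K, (f x - p x) * s x = 0) ∧
        ∀ e ∈ sides K, sideInt e (fun x => (f x - p x) ^ 2)
          ≤ C * Metric.diam (simplex e) * ∫ x in simplex K, ‖fderiv ℝ f x‖ ^ 2)
    {θ : ℝ} (hθ : 0 < θ) :
    T.gammaInt (fun K e x => f x * flux τ q u uhat K e x)
      ≤ (θ + ((d : ℝ) + 1) * C * D / 2) * (∫ x in T.domain, ‖fderiv ℝ f x‖ ^ 2)
        + (4 * θ)⁻¹ * T.volInt (fun K x => ‖q K x‖ ^ 2) + T.tauForm τ u uhat / 2 := by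
  choose! p hp hpo hpe using hproj
  have hfc := hf.continuous
  have hfd := hf.continuous_fderiv one_ne_zero
  have hD0 : 0 ≤ D := (T.hTauNorm τ).2.trans hD
  have hκ0 : 0 ≤ θ + ((d : ℝ) + 1) * C * D / 2 := by positivity
  rw [gammaInt_mul_flux hd hq hu huhat hdiv hflux hf hp hpo]
  -- Passing from the domain to the sum over elements on the right reduces the claim to one element
  -- at a time.
  refine le_trans ?_ (add_le_add_left (add_le_add_left (mul_le_mul_of_nonneg_left
    (T.sum_setIntegral_le (f := fun x => ‖fderiv ℝ f x‖ ^ 2) (hfd.norm.pow 2) fun x => sq_nonneg _) hκ0) _) _)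
  unfold volInt tauForm bdryInt
  rw [Finset.mul_sum, Finset.mul_sum, Finset.sum_div, ← Finset.sum_add_distrib,
    ← Finset.sum_add_distrib, ← Finset.sum_add_distrib]
  refine Finset.sum_le_sum fun K hK => ?_
  have hKc := isCompact_simplex K
  have hqc : Continuous (q K) := (contDiff_of_mem_vecPolys (n := 1) (hq K hK)).continuous
  have huc := continuous_of_mem_polys (hu K hK)
  have hpc := continuous_of_mem_polys (hp K hK)
  have hio : ∀ {g : E d → ℝ}, Continuous g → IntegrableOn g (simplex K) := fun hg =>
    hg.continuousOn.integrableOn_compact hKc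
  set G := ∫ x in simplex K, ‖fderiv ℝ f x‖ ^ 2 with hG
  have hG0 : 0 ≤ G := integral_nonneg fun x => sq_nonneg _
  have h1 : ∫ x in simplex K, fderiv ℝ f x (q K x)
      ≤ θ * G + (4 * θ)⁻¹ * ∫ x in simplex K, ‖q K x‖ ^ 2 := by
    rw [hG, ← integral_const_mul, ← integral_const_mul,
      ← integral_add (hio (by fun_prop)) (hio (by fun_prop))]
    refine setIntegral_mono_on (hio (hfd.clm_apply hqc)) (hio (by fun_prop)) hKc.measurableSet
      fun x _ => ?_
    have h2 := (le_abs_self _).trans ((fderiv ℝ f x).le_opNorm (q K x))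
    refine h2.trans ?_
    -- Young's inequality with weight θ as a completed square; θ is later fixed between M/4 and 1.
    have h3 : 0 ≤ (4 * θ)⁻¹ * (2 * θ * ‖fderiv ℝ f x‖ - ‖q K x‖) ^ 2 := by positivity
    have h4 : (4 * θ)⁻¹ * (2 * θ * ‖fderiv ℝ f x‖ - ‖q K x‖) ^ 2
        = θ * ‖fderiv ℝ f x‖ ^ 2 + (4 * θ)⁻¹ * ‖q K x‖ ^ 2 - ‖fderiv ℝ f x‖ * ‖q K x‖ := by
      field_simp
      ring
    linarith
  have h2 : ∀ e ∈ sides K, sideInt e (fun x => τ K e * (u K x - uhat e x) * (f x - p K x))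
      ≤ sideInt e (fun x => τ K e * (u K x - uhat e x) * (u K x - uhat e x)) / 2
        + C * D / 2 * G := by
    intro e he
    have huh := continuousOn_uhat huhat hK he
    have hτe := hτ K hK e he
    have h3 : sideInt e (fun x => τ K e * (u K x - uhat e x) * (f x - p K x))
        ≤ sideInt e (fun x => τ K e * (u K x - uhat e x) * (u K x - uhat e x)) / 2
          + τ K e / 2 * sideInt e (fun x => (f x - p K x) ^ 2) := by
      unfold sideInt
      rw [← integral_div, ← integral_const_mul, ← integral_add]
      · refine setIntegral_mono_on ?_ ?_ (isCompact_simplex e).measurableSet fun x _ => ?_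
        · refine integrableOn_side hK he hd ?_; fun_prop
        · refine (integrableOn_side hK he hd ?_).add (integrableOn_side hK he hd ?_) <;> fun_prop
        · have := mul_nonneg hτe (sq_nonneg ((u K x - uhat e x) - (f x - p K x)))
          linarith
      · refine integrableOn_side hK he hd ?_; fun_prop
      · refine integrableOn_side hK he hd ?_; fun_prop
    have h4 := mul_le_mul_of_nonneg_left (hpe K hK e he) (by positivity : 0 ≤ τ K e / 2)
    have h5 : τ K e / 2 * (C * Metric.diam (simplex e) * G) ≤ C * D / 2 * G := by
      have h6 := mul_le_mul_of_nonneg_left (tau_mul_diam_le hD hK he)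
        (by positivity : 0 ≤ C * G / 2)
      linarith
    linarith
  have h3 := Finset.sum_le_sum h2
  have hsc : (sides K).card = d + 1 := by
    rw [sides, Finset.card_powersetCard, card_of_mem_elements hK, Nat.choose_succ_self_right]
  rw [Finset.sum_add_distrib, Finset.sum_const, hsc, nsmul_eq_mul, ← Finset.sum_div] at h3
  push_cast at h3
  beta_reduce
  linarith

end Mesh

/-! ### Limits of smooth functions -/

lemma tendsto_integral_norm_sq {α F : Type*} [MeasurableSpace α] [NormedAddCommGroup F]
    [InnerProductSpace ℝ F] {μ : Measure α} {f : ℕ → α → F} {g : α → F}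
    (hf : ∀ n, MemLp (f n) 2 μ) (hg : MemLp g 2 μ)
    (hlim : Tendsto (fun n => eLpNorm (fun x => f n x - g x) 2 μ) atTop (𝓝 0)) :
    Tendsto (fun n => ∫ x, ‖f n x‖ ^ 2 ∂μ) atTop (𝓝 (∫ x, ‖g x‖ ^ 2 ∂μ)) := by
  have hint : ∀ {h : α → F} (hh : MemLp h 2 μ), ∫ x, ‖h x‖ ^ 2 ∂μ = ‖hh.toLp h‖ ^ 2 := by
    intro h hh
    rw [← real_inner_self_eq_norm_sq, L2.inner_def]
    refine integral_congr_ae ?_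
    filter_upwards [hh.coeFn_toLp] with x hx
    rw [hx, real_inner_self_eq_norm_sq]
  simp_rw [hint (hf _), hint hg]
  have h1 : Tendsto (fun n => (hf n).toLp (f n)) atTop (𝓝 (hg.toLp g)) :=
    (Lp.tendsto_Lp_iff_tendsto_eLpNorm'' f hf g hg).2 hlim
  exact h1.norm.pow 2

/-- On a finite measure space `L²` convergence implies `L¹` convergence, and a bounded factor
preserves it. -/
lemma tendsto_integral_mul_of_L2 {α : Type*} [MeasurableSpace α] {μ : Measure α}
    [IsFiniteMeasure μ] {f : ℕ → α → ℝ} {g h : α → ℝ} (hf : ∀ n, MemLp (f n) 2 μ)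
    (hg : MemLp g 2 μ) (hh : AEStronglyMeasurable h μ) {C : ℝ} (hC : ∀ᵐ x ∂μ, ‖h x‖ ≤ C)
    (hlim : Tendsto (fun n => eLpNorm (fun x => f n x - g x) 2 μ) atTop (𝓝 0)) :
    Tendsto (fun n => ∫ x, f n x * h x ∂μ) atTop (𝓝 (∫ x, g x * h x ∂μ)) := by
  have hint : ∀ {f : α → ℝ}, MemLp f 2 μ → Integrable (fun x => f x * h x) μ := fun hf =>
    (hf.integrable (by norm_num)).mul_bdd hh hC
  refine tendsto_integral_of_L1' _ (hint hg).aestronglyMeasurable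
    (Eventually.of_forall fun n => hint (hf n)) ?_
  set M : ℝ≥0∞ := μ Set.univ ^ (1 / (1 : ℝ≥0∞).toReal - 1 / (2 : ℝ≥0∞).toReal) with hM
  have hMt : M ≠ ∞ := by
    rw [hM]
    refine ENNReal.rpow_ne_top_of_nonneg (by norm_num) (measure_ne_top _ _)
  have hbound : ∀ n, eLpNorm ((fun x => f n x * h x) - fun x => g x * h x) 1 μ
      ≤ ENNReal.ofReal C * (eLpNorm (fun x => f n x - g x) 2 μ * M) := by
    intro n
    refine (eLpNorm_le_mul_eLpNorm_of_ae_le_mul (g := fun x => f n x - g x) (c := C) ?_ 1).trans ?_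
    · filter_upwards [hC] with x hx
      simp only [Pi.sub_apply]
      rw [← sub_mul, norm_mul, mul_comm]
      exact mul_le_mul_of_nonneg_right hx (norm_nonneg _)
    · gcongr
      exact eLpNorm_le_eLpNorm_mul_rpow_measure_univ (by norm_num)
        ((hf n).sub hg).aestronglyMeasurable
  refine tendsto_of_tendsto_of_tendsto_of_le_of_le tendsto_const_nhds ?_
    (fun n => zero_le) hbound
  have h1 := ENNReal.Tendsto.const_mul (a := ENNReal.ofReal C)
    (ENNReal.Tendsto.mul_const (b := M) hlim (Or.inr hMt)) (Or.inr ENNReal.ofReal_ne_top)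
  simpa using h1

lemma norm_gradient {d : ℕ} (f : E d → ℝ) (x : E d) : ‖gradient f x‖ = ‖fderiv ℝ f x‖ :=
  LinearIsometryEquiv.norm_map _ _

lemma continuous_gradient {d : ℕ} {f : E d → ℝ} (hf : ContDiff ℝ 1 f) :
    Continuous (gradient f) :=
  (InnerProductSpace.toDual ℝ (E d)).symm.continuous.comp (hf.continuous_fderiv one_ne_zero)

/-! ### Passage to the trace of an H¹ function, and the weighted norm of q -/

namespace Mesh

open scoped Classical

variable {d : ℕ} {T : Mesh d} {k : ℕ} {τ : Finset (E d) → Finset (E d) → ℝ}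
  {q : Finset (E d) → E d → E d} {u uhat : Finset (E d) → E d → ℝ}

/-- Surface measure on a side in Γ is dominated by `bdryMeasure`, so `L²` convergence on the
boundary restricts to each side, where the continuous factor is bounded. -/
lemma tendsto_gammaInt (hd : 0 < d) {F : Finset (E d) → Finset (E d) → E d → ℝ}
    (hF : ∀ K ∈ T.elements, ∀ e ∈ sides K, ContinuousOn (F K e) (simplex e))
    {v : ℕ → E d → ℝ} (hv : ∀ n, Continuous (v n)) {g : E d → ℝ}
    (hg : MemLp g 2 (bdryMeasure T.domain))
    (hlim : Tendsto (fun n => eLpNorm (fun x => v n x - g x) 2 (bdryMeasure T.domain)) atTop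
      (𝓝 0)) :
    Tendsto (fun n => T.gammaInt fun K e x => v n x * F K e x) atTop
      (𝓝 (T.gammaInt fun K e x => g x * F K e x)) := by
  unfold gammaInt
  refine tendsto_finsetSum _ fun K hK => tendsto_finsetSum _ fun e he => ?_
  obtain ⟨he, heb⟩ := Finset.mem_filter.1 he
  have hec := isCompact_simplex e
  set μ := (Measure.euclideanHausdorffMeasure (d - 1)).restrict (simplex e) with hμ
  have hle : μ ≤ bdryMeasure T.domain := Measure.restrict_mono heb le_rfl
  have hfin : IsFiniteMeasure μ := by
    have h1 : Integrable (fun _ => (1 : ℝ)) μ := integrableOn_side hK he hd continuousOn_const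
    exact (integrable_const_iff.1 h1).resolve_left one_ne_zero
  have hbd : ∀ {f : E d → ℝ}, ContinuousOn f (simplex e) → ∃ C, ∀ᵐ x ∂μ, ‖f x‖ ≤ C := by
    intro f hf
    obtain ⟨C, hC⟩ := hec.exists_bound_of_continuousOn hf
    exact ⟨C, (ae_restrict_iff' hec.measurableSet).2 (ae_of_all _ hC)⟩
  obtain ⟨C, hC⟩ := hbd (hF K hK e he)
  refine tendsto_integral_mul_of_L2 (fun n => ?_) (hg.mono_measure hle)
    ((hF K hK e he).aestronglyMeasurable hec.measurableSet) hC ?_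
  · obtain ⟨C', hC'⟩ := hbd (hv n).continuousOn
    exact MemLp.of_bound ((hv n).aestronglyMeasurable) C' hC'
  · exact tendsto_of_tendsto_of_tendsto_of_le_of_le tendsto_const_nhds hlim (fun n => zero_le)
      fun n => eLpNorm_mono_measure _ hle

/-- Pointwise, κ ≤ M gives κ⁻¹ ≥ M⁻¹. Boundedness of κ⁻¹ makes the weighted integrand integrable,
without which its integral would be the default value 0. -/
lemma le_volInt_inner {κ : E d → ℝ} (hκ : IsDiffusion T.domain κ) {M : ℝ}
    (hM : eLpNorm κ ⊤ (volume.restrict T.domain) ≤ ENNReal.ofReal M) (hM0 : 0 < M)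
    (hq : q ∈ T.Vh k) :
    M⁻¹ * T.volInt (fun K x => ‖q K x‖ ^ 2)
      ≤ T.volInt (fun K x => inner ℝ ((κ x)⁻¹ • q K x) (q K x)) := by
  unfold volInt
  rw [Finset.mul_sum]
  refine Finset.sum_le_sum fun K hK => ?_
  have hKc := isCompact_simplex K
  have hle := restrict_simplex_le hK
  have hqc : Continuous (q K) := (contDiff_of_mem_vecPolys (n := 1) (hq K hK)).continuous
  have hq2 : IntegrableOn (fun x => ‖q K x‖ ^ 2) (simplex K) :=
    (hqc.norm.pow 2).continuousOn.integrableOn_compact hKc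
  have hκb : ∀ᵐ x ∂(volume.restrict (simplex K)), ‖κ x‖ₑ ≤ ENNReal.ofReal M := by
    refine hle.absolutelyContinuous.ae_le ?_
    rw [eLpNorm_exponent_top] at hM
    filter_upwards [enorm_ae_le_eLpNormEssSup κ (volume.restrict T.domain)] with x hx
    exact hx.trans hM
  have hκp : ∀ᵐ x ∂(volume.restrict (simplex K)), 0 < κ x := hle.absolutelyContinuous.ae_le hκ.pos
  have hinv : MemLp (fun x => (κ x)⁻¹) ⊤ (volume.restrict (simplex K)) :=
    hκ.inv_memLp.mono_measure hle
  have hform : ∀ x, inner ℝ ((κ x)⁻¹ • q K x) (q K x) = (κ x)⁻¹ * ‖q K x‖ ^ 2 := by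
    intro x
    rw [inner_smul_left, real_inner_self_eq_norm_sq]
    simp
  simp_rw [hform]
  rw [← integral_const_mul]
  refine integral_mono_ae (hq2.const_mul _) ?_ ?_
  · have h1 := MemLp.mul' (p := ⊤) (q := 1) (r := 1) (memLp_one_iff_integrable.2 hq2) hinv
    exact memLp_one_iff_integrable.1 h1
  · filter_upwards [hκb, hκp] with x hx hp
    refine mul_le_mul_of_nonneg_right ?_ (sq_nonneg _)
    refine inv_anti₀ hp ?_
    rw [← ofReal_norm, ENNReal.ofReal_le_ofReal_iff hM0.le] at hx
    exact (Real.le_norm_self _).trans hx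

/-- The boundary term for `u⋆ ∈ H¹(Ω)` with trace `g`. -/
lemma gammaInt_trace_mul_flux_le (hd : 0 < d) (hq : q ∈ T.Vh k) (hu : u ∈ T.Wh k)
    (huhat : uhat ∈ T.Mh k) (hdiv : T.DivEq k τ q u uhat) (hflux : T.FluxEq k τ q u uhat)
    (hτ : ∀ K ∈ T.elements, ∀ e ∈ sides K, 0 ≤ τ K e) {D : ℝ}
    (hD : (T.hTauNorm τ : ℝ) ≤ D) {C : ℝ} (hC : 0 ≤ C)
    (hproj : ∀ f : E d → ℝ, ContDiff ℝ 1 f → ∀ K ∈ T.elements, ∃ p ∈ polys d k,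
      (∀ s ∈ polys d k, ∫ x in simplex K, (f x - p x) * s x = 0) ∧
        ∀ e ∈ sides K, sideInt e (fun x => (f x - p x) ^ 2)
          ≤ C * Metric.diam (simplex e) * ∫ x in simplex K, ‖fderiv ℝ f x‖ ^ 2)
    {θ : ℝ} (hθ : 0 < θ) {ustar : E d → ℝ} {G : E d → E d} {g : E d → ℝ}
    (hG : IsH1 T.domain ustar G) (hg : IsTrace T.domain ustar G g) :
    T.gammaInt (fun K e x => g x * flux τ q u uhat K e x)
      ≤ (θ + ((d : ℝ) + 1) * C * D / 2) * (∫ x in T.domain, ‖G x‖ ^ 2)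
        + (4 * θ)⁻¹ * T.volInt (fun K x => ‖q K x‖ ^ 2) + T.tauForm τ u uhat / 2 := by
  obtain ⟨v, hv, -, hv2, hv3⟩ := hg.approx
  have hv1 : ∀ n, ContDiff ℝ 1 (v n) := fun n => (hv n).of_le (by simp)
  have hlim1 := tendsto_gammaInt hd (F := flux τ q u uhat)
    (fun K hK e he => continuousOn_flux hq hu huhat hK he)
    (fun n => (hv1 n).continuous) hg.memLp hv3
  have hmem : ∀ n, MemLp (gradient (v n)) 2 (volume.restrict T.domain) := fun n =>
    (memLp_of_continuous T.isCompact_space (continuous_gradient (hv1 n))).mono_measure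
      (Measure.restrict_mono interior_subset le_rfl)
  have hlim2 := tendsto_integral_norm_sq hmem hG.grad_memLp hv2
  refine le_of_tendsto_of_tendsto' hlim1
    (((hlim2.const_mul (θ + ((d : ℝ) + 1) * C * D / 2)).add_const
      ((4 * θ)⁻¹ * T.volInt (fun K x => ‖q K x‖ ^ 2))).add_const (T.tauForm τ u uhat / 2))
    fun n => ?_
  simp_rw [norm_gradient]
  exact gammaInt_mul_flux_le hd hq hu huhat hdiv hflux hτ hD hC (hv1 n) (hproj _ (hv1 n)) hθ

end Mesh

end HDG

/-! ### Choice of constants and absorption of the boundary term -/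

theorem lemma2p3 (d k : ℕ) (hd : d = 2 ∨ d = 3) (σ κmax : ℝ) (hκmax : κmax < 4) :
    ∃ C D : ℝ, 0 < C ∧ 0 < D ∧
      ∀ (T : Mesh d), T.IsShapeRegular σ →
      ∀ (κ : E d → ℝ), IsDiffusion T.domain κ →
        eLpNorm κ ⊤ (volume.restrict T.domain) ≤ ENNReal.ofReal κmax →
      ∀ (τ : Finset (E d) → Finset (E d) → ℝ),
        (∀ K ∈ T.elements, ∀ e ∈ sides K, 0 ≤ τ K e) → (T.hTauNorm τ : ℝ) ≤ D →
      ∀ q ∈ T.Vh k, ∀ u ∈ T.Wh k, ∀ uhat ∈ T.Mh k,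
        T.DivEq k τ q u uhat → T.FluxEq k τ q u uhat →
      ∀ (ustar : E d → ℝ) (G : E d → E d) (g : E d → ℝ),
        IsH1 T.domain ustar G → IsTrace T.domain ustar G g →
        C * (T.volInt (fun K x => ‖q K x‖ ^ 2) + (∫ x in T.domain, ‖G x‖ ^ 2)
            + T.tauForm τ u uhat)
          ≤ T.formQ κ τ q u uhat G g := by
  have hd2 : 2 ≤ d := by omega
  obtain ⟨Ct, hCt0, hCt⟩ := exists_projection_trace d k hd2 σ
  -- κmax may be nonpositive; the maximum with 1 makes the bound positive while keeping it below 4.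
  set M : ℝ := max κmax 1 with hM
  have hM1 : 1 ≤ M := le_max_right _ _
  have hM4 : M < 4 := max_lt hκmax (by norm_num)
  have hM0 : 0 < M := by linarith
  -- The midpoint of M/4 and 1, so that both M < 4θ and θ < 1 hold strictly.
  set θ : ℝ := (1 + M / 4) / 2 with hθ
  have hθ0 : 0 < θ := by positivity
  have hθ1 : θ < 1 := by rw [hθ]; linarith
  have hθM : M < 4 * θ := by rw [hθ]; linarith
  -- Chosen so that the τ-term uses up at most half of the remaining 1 - θ of the gradient norm. The
  -- added 1 covers `Ct` = 0.
  set D : ℝ := (1 - θ) / (((d : ℝ) + 1) * Ct + 1) with hD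
  have hD0 : 0 < D := div_pos (by linarith) (by positivity)
  have hCD : ((d : ℝ) + 1) * Ct * D ≤ 1 - θ := by
    rw [hD, mul_div_assoc', div_le_iff₀ (by positivity)]
    nlinarith
  have ha : 0 < M⁻¹ - (4 * θ)⁻¹ := sub_pos.2 (inv_strictAnti₀ hM0 hθM)
  -- The three entries are what is left of the coefficients of ‖q‖², ‖G‖² and the τ-form after
  -- absorption.
  set C : ℝ := min (M⁻¹ - (4 * θ)⁻¹) (min ((1 - θ) / 2) (1 / 2)) with hC
  have hC1 : C ≤ M⁻¹ - (4 * θ)⁻¹ := min_le_left _ _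
  have hC2 : C ≤ (1 - θ) / 2 := (min_le_right _ _).trans (min_le_left _ _)
  have hC3 : C ≤ 1 / 2 := (min_le_right _ _).trans (min_le_right _ _)
  refine ⟨C, D, lt_min ha (lt_min (by linarith) (by norm_num)), hD0, ?_⟩
  intro T hT κ hκ hκM τ hτ hτD q hq u hu uhat huhat hdiv hflux ustar G g hG hg
  have hproj : ∀ f : E d → ℝ, ContDiff ℝ 1 f → ∀ K ∈ T.elements, ∃ p ∈ polys d k,
      (∀ s ∈ polys d k, ∫ x in simplex K, (f x - p x) * s x = 0) ∧
        ∀ e ∈ sides K, sideInt e (fun x => (f x - p x) ^ 2)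
          ≤ Ct * Metric.diam (simplex e) * ∫ x in simplex K, ‖fderiv ℝ f x‖ ^ 2 := by
    intro f hf K hK
    obtain ⟨c, r, hr, hball, hdiam⟩ := hT K hK
    exact hCt K (Mesh.indep_of_mem_elements hK) (Mesh.card_of_mem_elements hK) c r hr hball hdiam
      f hf
  have hgamma := Mesh.gammaInt_trace_mul_flux_le (by omega) hq hu huhat hdiv hflux hτ hτD hCt0
    hproj hθ0 hG hg
  have hvol := Mesh.le_volInt_inner hκ
    (hκM.trans (ENNReal.ofReal_le_ofReal (le_max_left κmax 1))) hM0 hq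
  have ht := Mesh.tauForm_nonneg (u := u) (uhat := uhat) hτ
  have hQ : 0 ≤ T.volInt (fun K x => ‖q K x‖ ^ 2) :=
    Finset.sum_nonneg fun K _ => integral_nonneg fun x => sq_nonneg _
  have hG2 : 0 ≤ ∫ x in T.domain, ‖G x‖ ^ 2 := integral_nonneg fun x => sq_nonneg _
  unfold Mesh.formQ
  set Q := T.volInt (fun K x => ‖q K x‖ ^ 2)
  set t := T.tauForm τ u uhat
  set G2 := ∫ x in T.domain, ‖G x‖ ^ 2
  have h1 := mul_le_mul_of_nonneg_right hC1 hQ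
  have h2 := mul_le_mul_of_nonneg_right hC2 hG2
  have h3 := mul_le_mul_of_nonneg_right hC3 ht
  have h4 := mul_le_mul_of_nonneg_right hCD hG2
  linarith
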